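/- Let $n \ge 1$ be an integer and let $\mu = (\mu_1,\dots,\mu_n)$ be a vector of non-negative integers with $\sum_{i=1}^n i\mu_i = n$. Put $k = \sum_{i=1}^n \mu_i$. A dissection of a convex $(n+2)$-gon with vertices $v_0,\dots,v_{n+1}$ (in clockwise order, indices modulo $n+2$) is a set of pairwise non-crossing diagonals. Let $\mathcal{A}_\mu$ be the set of dissections that cut the $(n+2)$-gon into subpolygons of which, for each $1 \le i \le n$, exactly $\mu_i$ are $(i+2)$-gons. Let $G_{n+2} = \langle \sigma \rangle$ be the cyclic group of order $n+2$ generated by the rotation $\sigma : v_i \mapsto v_{i-1}$; it acts on $\mathcal{A}_\mu$. Let $$a_\mu(q) = \frac{1}{[n+1]_q} \cdot \frac{[n+k]_q!}{[k]_q!\,[n]_q!} \cdot \frac{[k]_q!}{[\mu_1]_q!\,[\mu_2]_q! \cdots [\mu_n]_q!},$$ where $[m]_q = 1 + q + \cdots + q^{m-1}$ and $[m]_q! = [1]_q [2]_q \cdots [m]_q$. Then $a_\mu(q)$ is a polynomial with integer coefficients, and the triple $(\mathcal{A}_\mu, G_{n+2}, a_\mu(q))$ exhibits the cyclic sieving phenomenon: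 for every primitive $(n+2)$-th root of unity $\zeta \in \mathbb{C}$ and every integer $j \ge 0$, the value $a_\mu(\zeta^j)$ equals the number of dissections in $\mathcal{A}_\mu$ that are fixed by $\sigma^j$. -/

import Mathlib

open Polynomial

namespace PolygonDissection

/-! ### The cyclic sieving phenomenon -/

/-- The triple `(X, G, P)` exhibits the cyclic sieving phenomenon: `G` is a cyclic group of order
`N` generated by `σ`, it acts on the finite set `X`, and for every primitive `N`-th root of unity
`ζ` and every `j`, the value `P(ζ ^ j)` is the number of fixed points of `σ ^ j`. -/
structure ExhibitsCSP (N : ℕ) (G X : Type*) [Group G] [MulAction G X] (σ : G) (P : ℤ[X]) :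
    Prop where
  finite : Finite X
  card_group : Nat.card G = N
  generates : ∀ g : G, g ∈ Subgroup.zpowers σ
  eval_eq : ∀ ζ : ℂ, IsPrimitiveRoot ζ N → ∀ j : ℕ,
    aeval (ζ ^ j) P = (Nat.card (MulAction.fixedBy X (σ ^ j)) : ℂ)

/-! ### Dissections of a polygon

The vertices `v_0, …, v_{N-1}` of the `N`-gon, in clockwise order, are the elements of `ZMod N`. -/

/-- Walking clockwise from `a`, one meets `c` after leaving `a` and before reaching `b`. -/
def Between {N : ℕ} (a c b : ZMod N) : Prop :=
  0 < (c - a).val ∧ (c - a).val < (b - a).val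

/-- `a` and `b` are the two ends of a side of the `N`-gon. -/
def IsSide {N : ℕ} (a b : ZMod N) : Prop := b - a = 1 ∨ a - b = 1

/-- A dissection: a set of diagonals (unordered pairs of distinct vertices that do not form a
side), no two of which cross. Two diagonals cross when the ends of one lie strictly on different
sides of the other. -/
structure IsDissection {N : ℕ} (T : Finset (Sym2 (ZMod N))) : Prop where
  diagonal : ∀ a b : ZMod N, s(a, b) ∈ T → a ≠ b ∧ ¬ IsSide a b
  noncrossing : ∀ a b c d : ZMod N, s(a, b) ∈ T → s(c, d) ∈ T → ¬ (Between a c b ∧ Between b d a)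

/-- `b` is the vertex of the inscribed polygon with vertex set `S` that follows `a` in clockwise
order. -/
def IsNext {N : ℕ} (S : Finset (ZMod N)) (a b : ZMod N) : Prop :=
  a ∈ S ∧ b ∈ S ∧ a ≠ b ∧ ∀ c ∈ S, ¬ Between a c b

/-- `S` is the vertex set of a subgon of `T`, that is, of one of the regions into which the
diagonals in `T` cut the polygon: the inscribed polygon on `S` is bounded by sides of the big
polygon and diagonals in `T`, and no diagonal in `T` passes through its interior. (As the diagonals
do not cross, one that enters the interior has both ends in `S`.) -/
structure IsSubgon {N : ℕ} (T : Finset (Sym2 (ZMod N))) (S : Finset (ZMod N)) : Prop where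
  three_le_card : 3 ≤ S.card
  boundary : ∀ a b : ZMod N, IsNext S a b → IsSide a b ∨ s(a, b) ∈ T
  interior : ∀ a b : ZMod N, a ∈ S → b ∈ S → s(a, b) ∈ T → IsNext S a b ∨ IsNext S b a

/-- The number of subgons of `T` with exactly `m` vertices. -/
noncomputable def numSubgons {N : ℕ} (T : Finset (Sym2 (ZMod N))) (m : ℕ) : ℕ :=
  {S : Finset (ZMod N) | IsSubgon T S ∧ S.card = m}.ncard

/-- The set `A_μ` of dissections of the `(n + 2)`-gon of type `μ`. The vector
`(μ_1, …, μ_n)` is indexed from zero: the entry at `i : Fin n` is `μ_{i+1}`, the number of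
`(i + 1 + 2)`-gons. -/
def DissectionsOfType (n : ℕ) (μ : Fin n → ℕ) : Type :=
  {T : Finset (Sym2 (ZMod (n + 2))) //
    IsDissection T ∧ ∀ i : Fin n, numSubgons T ((i : ℕ) + 1 + 2) = μ i}

/-! ### The rotation action -/

/-- The rotation of the `N`-gon, `v_i ↦ v_{i-1}`. -/
def rotation (N : ℕ) : Equiv.Perm (ZMod N) := Equiv.subRight 1

/-- The group of rotations of the `N`-gon, generated by `rotation N`. -/
abbrev RotationGroup (N : ℕ) : Type := Subgroup.zpowers (rotation N)

/-- The generator `σ` of the group of rotations. -/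
def rotationGen (N : ℕ) : RotationGroup N := ⟨rotation N, Subgroup.mem_zpowers _⟩

/-- The effect of a permutation of the vertices on a set of diagonals. -/
def mapDiagonals {N : ℕ} (g : Equiv.Perm (ZMod N)) (T : Finset (Sym2 (ZMod N))) :
    Finset (Sym2 (ZMod N)) :=
  T.image (Sym2.map g)

theorem rotation_sub {N : ℕ} (g : RotationGroup N) (x y : ZMod N) :
    g.1 x - g.1 y = x - y := by
  obtain ⟨g, hg⟩ := g
  have key : ∀ h ∈ Subgroup.zpowers (rotation N), ∀ x y : ZMod N, h x - h y = x - y := by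
    intro h hh
    rw [Subgroup.zpowers_eq_closure] at hh
    induction hh using Subgroup.closure_induction with
    | mem z hz =>
      obtain rfl := Set.mem_singleton_iff.1 hz
      intro x y
      simp [rotation]
    | one => intro x y; rfl
    | mul a b _ _ ha hb =>
      intro x y
      rw [Equiv.Perm.mul_apply, Equiv.Perm.mul_apply, ha, hb]
    | inv a _ ha =>
      intro x y
      have := ha (a⁻¹ x) (a⁻¹ y)
      simpa using this.symm
  exact key g hg x y

theorem mapDiagonals_one {N : ℕ} (T : Finset (Sym2 (ZMod N))) : mapDiagonals 1 T = T := by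
  have h : (Sym2.map ((1 : Equiv.Perm (ZMod N)) : ZMod N → ZMod N)) = id := Sym2.map_id
  rw [mapDiagonals, h, Finset.image_id]

theorem mapDiagonals_mul {N : ℕ} (g h : Equiv.Perm (ZMod N)) (T : Finset (Sym2 (ZMod N))) :
    mapDiagonals (g * h) T = mapDiagonals g (mapDiagonals h T) := by
  rw [mapDiagonals, mapDiagonals, mapDiagonals, Finset.image_image, ← Sym2.map_comp]
  rfl

theorem mk_mem_mapDiagonals {N : ℕ} (g : Equiv.Perm (ZMod N)) (T : Finset (Sym2 (ZMod N)))
    (a b : ZMod N) : s(g a, g b) ∈ mapDiagonals g T ↔ s(a, b) ∈ T := by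
  rw [mapDiagonals, ← Sym2.map_mk, (Sym2.map.injective g.injective).mem_finset_image]

theorem between_rotation {N : ℕ} (g : RotationGroup N) (a c b : ZMod N) :
    Between (g.1 a) (g.1 c) (g.1 b) ↔ Between a c b := by
  simp only [Between, rotation_sub]

theorem isSide_rotation {N : ℕ} (g : RotationGroup N) (a b : ZMod N) :
    IsSide (g.1 a) (g.1 b) ↔ IsSide a b := by
  simp only [IsSide, rotation_sub]

theorem isDissection_rotation {N : ℕ} (g : RotationGroup N) {T : Finset (Sym2 (ZMod N))}
    (hT : IsDissection T) : IsDissection (mapDiagonals g.1 T) := by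
  constructor
  · intro a b
    obtain ⟨a, rfl⟩ := g.1.surjective a
    obtain ⟨b, rfl⟩ := g.1.surjective b
    rw [mk_mem_mapDiagonals, isSide_rotation, g.1.injective.ne_iff]
    exact hT.diagonal a b
  · intro a b c d
    obtain ⟨a, rfl⟩ := g.1.surjective a
    obtain ⟨b, rfl⟩ := g.1.surjective b
    obtain ⟨c, rfl⟩ := g.1.surjective c
    obtain ⟨d, rfl⟩ := g.1.surjective d
    rw [mk_mem_mapDiagonals, mk_mem_mapDiagonals, between_rotation, between_rotation]
    exact hT.noncrossing a b c d

theorem isNext_rotation {N : ℕ} (g : RotationGroup N) (S : Finset (ZMod N)) (a b : ZMod N) :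
    IsNext (S.image g.1) (g.1 a) (g.1 b) ↔ IsNext S a b := by
  simp only [IsNext, g.1.injective.mem_finset_image, g.1.injective.ne_iff,
    Finset.forall_mem_image, between_rotation]

theorem isSubgon_rotation {N : ℕ} (g : RotationGroup N) {T : Finset (Sym2 (ZMod N))}
    {S : Finset (ZMod N)} (hS : IsSubgon T S) : IsSubgon (mapDiagonals g.1 T) (S.image g.1) := by
  constructor
  · rw [Finset.card_image_of_injective _ g.1.injective]
    exact hS.three_le_card
  · intro a b
    obtain ⟨a, rfl⟩ := g.1.surjective a
    obtain ⟨b, rfl⟩ := g.1.surjective b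
    rw [isNext_rotation, isSide_rotation, mk_mem_mapDiagonals]
    exact hS.boundary a b
  · intro a b
    obtain ⟨a, rfl⟩ := g.1.surjective a
    obtain ⟨b, rfl⟩ := g.1.surjective b
    rw [isNext_rotation, isNext_rotation, mk_mem_mapDiagonals, g.1.injective.mem_finset_image,
      g.1.injective.mem_finset_image]
    exact hS.interior a b

theorem numSubgons_le_rotation {N : ℕ} [NeZero N] (g : RotationGroup N)
    (T : Finset (Sym2 (ZMod N))) (m : ℕ) :
    numSubgons T m ≤ numSubgons (mapDiagonals g.1 T) m := by
  refine Set.ncard_le_ncard_of_injOn (fun S => S.image g.1) ?_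
    (Finset.image_injective g.1.injective).injOn (Set.toFinite _)
  rintro S ⟨hS, hm⟩
  exact ⟨isSubgon_rotation g hS, by rw [Finset.card_image_of_injective _ g.1.injective, hm]⟩

theorem numSubgons_rotation {N : ℕ} [NeZero N] (g : RotationGroup N)
    (T : Finset (Sym2 (ZMod N))) (m : ℕ) :
    numSubgons (mapDiagonals g.1 T) m = numSubgons T m := by
  refine le_antisymm ?_ (numSubgons_le_rotation g T m)
  have h := numSubgons_le_rotation g⁻¹ (mapDiagonals g.1 T) m
  rwa [← mapDiagonals_mul, ← Subgroup.coe_mul, inv_mul_cancel, Subgroup.coe_one,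
    mapDiagonals_one] at h

/-- Rotations act on the dissections of type `μ` by moving the diagonals. -/
instance (n : ℕ) (μ : Fin n → ℕ) :
    MulAction (RotationGroup (n + 2)) (DissectionsOfType n μ) where
  smul g T := ⟨mapDiagonals g.1 T.1, isDissection_rotation g T.2.1,
    fun i => (numSubgons_rotation g T.1 _).trans (T.2.2 i)⟩
  one_smul T := Subtype.ext (mapDiagonals_one T.1)
  mul_smul g h T := Subtype.ext (mapDiagonals_mul g.1 h.1 T.1)

/-! ### The polynomial -/

/-- The `q`-integer `[m]_q = 1 + q + ⋯ + q ^ (m - 1)`. -/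
noncomputable def qInt (m : ℕ) : ℤ[X] := ∑ i ∈ Finset.range m, X ^ i

/-- The `q`-factorial `[m]_q! = [1]_q [2]_q ⋯ [m]_q`. -/
noncomputable def qFactorial (m : ℕ) : ℤ[X] := ∏ i ∈ Finset.range m, qInt (i + 1)

/-- The field `ℚ(q)`, as the fraction field of `ℤ[q]`. -/
abbrev QField : Type := FractionRing ℤ[X]

/-- The `q`-binomial coefficient `[m]_q! / ([j]_q! [m - j]_q!)`, for `j ≤ m`. -/
noncomputable def qBinom (m j : ℕ) : QField :=
  if j ≤ m then
    algebraMap ℤ[X] QField (qFactorial m) /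
      (algebraMap ℤ[X] QField (qFactorial j) * algebraMap ℤ[X] QField (qFactorial (m - j)))
  else 0

/-- The `q`-multinomial coefficient `[k]_q! / ([μ_1]_q! ⋯ [μ_n]_q!)`, where `k = ∑ μ_i`. -/
noncomputable def qMultinomial {n : ℕ} (μ : Fin n → ℕ) : QField :=
  algebraMap ℤ[X] QField (qFactorial (∑ i, μ i)) /
    ∏ i, algebraMap ℤ[X] QField (qFactorial (μ i))

/-- The rational function `a_μ(q)`. -/
noncomputable def aMu (n : ℕ) (μ : Fin n → ℕ) : QField :=
  1 / algebraMap ℤ[X] QField (qInt (n + 1)) * qBinom (n + ∑ i, μ i) (∑ i, μ i) * qMultinomial μ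

end PolygonDissection

namespace PolygonDissection

/-! ### The `q`-factorial and cyclotomic polynomials -/

theorem qFactorial_succ (m : ℕ) : qFactorial (m + 1) = qFactorial m * qInt (m + 1) :=
  Finset.prod_range_succ _ _

theorem qFactorial_zero : qFactorial 0 = 1 := rfl

theorem qInt_eq_prod_cyclotomic {m M : ℕ} (h : m + 1 ≤ M) :
    qInt (m + 1) = ∏ d ∈ Finset.Icc 2 M, if d ∣ m + 1 then cyclotomic d ℤ else 1 := by
  rw [qInt, ← prod_cyclotomic_eq_geom_sum (Nat.succ_pos m), Finset.prod_ite, Finset.prod_const_one,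
    mul_one]
  refine Finset.prod_congr ?_ fun _ _ => rfl
  ext d
  simp only [Finset.mem_erase, Nat.mem_divisors, Finset.mem_filter, Finset.mem_Icc]
  constructor
  · rintro ⟨h1, h2, -⟩
    have := Nat.le_of_dvd (Nat.succ_pos m) h2
    have := Nat.pos_of_dvd_of_pos h2 (Nat.succ_pos m)
    exact ⟨⟨by omega, by omega⟩, h2⟩
  · rintro ⟨⟨h1, -⟩, h2⟩
    exact ⟨by omega, h2, by omega⟩

theorem qFactorial_eq_prod_cyclotomic {m M : ℕ} (h : m ≤ M) :
    qFactorial m = ∏ d ∈ Finset.Icc 2 M, cyclotomic d ℤ ^ (m / d) := by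
  induction m with
  | zero => simp [qFactorial_zero]
  | succ m ih =>
    rw [qFactorial_succ, ih (by omega), qInt_eq_prod_cyclotomic h, ← Finset.prod_mul_distrib]
    refine Finset.prod_congr rfl fun d _ => ?_
    rw [Nat.succ_div]
    split_ifs <;> simp [pow_succ]

theorem qFactorial_ne_zero (m : ℕ) : qFactorial m ≠ 0 := by
  rw [qFactorial_eq_prod_cyclotomic le_rfl]
  exact Finset.prod_ne_zero_iff.2 fun d _ => pow_ne_zero _ (cyclotomic_ne_zero d ℤ)

theorem floor_sum_le {n : ℕ} {μ : Fin n → ℕ} (hμ : ∑ i : Fin n, ((i : ℕ) + 1) * μ i = n)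
    {d : ℕ} (hd : 2 ≤ d) : (n + 1) / d + ∑ i, μ i / d ≤ (n + ∑ i, μ i) / d := by
  have h0 : 0 < d := by omega
  set f := ∑ i, μ i / d
  set r := ∑ i, μ i % d
  have h1 : ∑ i, μ i = d * f + r := by
    rw [Finset.mul_sum, ← Finset.sum_add_distrib]
    exact Finset.sum_congr rfl fun i _ => (Nat.div_add_mod _ _).symm
  have h2 : n = d * (∑ i : Fin n, ((i : ℕ) + 1) * (μ i / d)) +
      ∑ i : Fin n, ((i : ℕ) + 1) * (μ i % d) := by
    conv_lhs => rw [← hμ]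
    rw [Finset.mul_sum, ← Finset.sum_add_distrib]
    refine Finset.sum_congr rfl fun i _ => ?_
    conv_lhs => rw [← Nat.div_add_mod (μ i) d]
    ring
  set g := ∑ i : Fin n, ((i : ℕ) + 1) * (μ i / d)
  set t := ∑ i : Fin n, ((i : ℕ) + 1) * (μ i % d) with ht
  rw [h1]
  rcases Nat.eq_zero_or_pos r with hr | hr
  · have ht0 : t = 0 := by
      refine Finset.sum_eq_zero fun i hi => ?_
      rw [Finset.sum_eq_zero_iff.1 hr i hi, mul_zero]
    have h3 : n = d * g := by omega
    rw [hr, add_zero, h3, Nat.mul_add_div h0, Nat.div_eq_of_lt (by omega : 1 < d), add_zero,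
      ← mul_add, Nat.mul_div_cancel_left _ h0]
  · rw [show n + (d * f + r) = d * f + (n + r) by ring, Nat.mul_add_div h0, add_comm]
    exact Nat.add_le_add_left (Nat.div_le_div_right (by omega)) _

theorem qFactorial_mul_prod_dvd {n : ℕ} {μ : Fin n → ℕ}
    (hμ : ∑ i : Fin n, ((i : ℕ) + 1) * μ i = n) :
    qFactorial (n + 1) * ∏ i, qFactorial (μ i) ∣ qFactorial (n + ∑ i, μ i) := by
  set M := n + 1 + ∑ i, μ i
  have hM (i : Fin n) : μ i ≤ M :=
    (Finset.single_le_sum (fun _ _ => Nat.zero_le _) (Finset.mem_univ i)).trans (by omega)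
  rw [qFactorial_eq_prod_cyclotomic (show n + 1 ≤ M by omega),
    qFactorial_eq_prod_cyclotomic (show n + ∑ i, μ i ≤ M by omega),
    Finset.prod_congr rfl fun i _ => qFactorial_eq_prod_cyclotomic (hM i), Finset.prod_comm,
    ← Finset.prod_mul_distrib]
  refine Finset.prod_dvd_prod_of_dvd _ _ fun d hd => ?_
  rw [Finset.prod_pow_eq_pow_sum, ← pow_add]
  exact pow_dvd_pow _ (floor_sum_le hμ (Finset.mem_Icc.1 hd).1)

theorem algebraMap_eq_aMu {n : ℕ} {μ : Fin n → ℕ} {P : ℤ[X]}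
    (hP : qFactorial (n + ∑ i, μ i) = qFactorial (n + 1) * (∏ i, qFactorial (μ i)) * P) :
    algebraMap ℤ[X] QField P = aMu n μ := by
  have hinj : Function.Injective (algebraMap ℤ[X] QField) := IsFractionRing.injective _ _
  have hne (m : ℕ) : algebraMap ℤ[X] QField (qFactorial m) ≠ 0 :=
    (map_ne_zero_iff _ hinj).2 (qFactorial_ne_zero m)
  have hq : algebraMap ℤ[X] QField (qInt (n + 1)) ≠ 0 := by
    intro h
    apply hne (n + 1)
    rw [qFactorial_succ, map_mul, h, mul_zero]
  have hprod : ∏ i, algebraMap ℤ[X] QField (qFactorial (μ i)) ≠ 0 :=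
    Finset.prod_ne_zero_iff.2 fun i _ => hne _
  rw [aMu, qBinom, if_pos (Nat.le_add_left _ _), Nat.add_sub_cancel, hP, qMultinomial,
    qFactorial_succ]
  simp only [map_mul, map_prod]
  have := hne n
  have := hne (∑ i, μ i)
  field_simp

/-! ### Values at roots of unity -/

theorem aeval_qInt (ω : ℂ) (m : ℕ) : aeval ω (qInt m) = ∑ i ∈ Finset.range m, ω ^ i := by
  simp [qInt]

theorem aeval_qInt_mul (ω : ℂ) (m : ℕ) : aeval ω (qInt m) * (ω - 1) = ω ^ m - 1 := by
  rw [aeval_qInt, geom_sum_mul]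

theorem aeval_qInt_mod {ω : ℂ} {d : ℕ} (hω : IsPrimitiveRoot ω d) (hd : 2 ≤ d) (m : ℕ) :
    aeval ω (qInt m) = aeval ω (qInt (m % d)) := by
  have h1 : ω - 1 ≠ 0 := sub_ne_zero.2 (hω.ne_one (by omega))
  apply mul_right_cancel₀ h1
  rw [aeval_qInt_mul, aeval_qInt_mul]
  conv_lhs => rw [← Nat.mod_add_div m d, pow_add, pow_mul, hω.pow_eq_one, one_pow, mul_one]

theorem aeval_qInt_self {ω : ℂ} {d : ℕ} (hω : IsPrimitiveRoot ω d) (hd : 2 ≤ d) :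
    aeval ω (qInt d) = 0 := by
  rw [aeval_qInt, hω.geom_sum_eq_zero (by omega)]

theorem aeval_qFactorial_ne_zero {ω : ℂ} {d : ℕ} (hω : IsPrimitiveRoot ω d) {r : ℕ}
    (hr : r < d) : aeval ω (qFactorial r) ≠ 0 := by
  rw [qFactorial, map_prod]
  refine Finset.prod_ne_zero_iff.2 fun l hl h => ?_
  have hl := Finset.mem_range.1 hl
  have := aeval_qInt_mul ω (l + 1)
  rw [h, zero_mul, eq_comm, sub_eq_zero] at this
  exact hω.pow_ne_one_of_pos_of_lt (Nat.succ_ne_zero l) (by omega) this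

theorem qInt_mul (d a : ℕ) : qInt (d * a) = qInt d * ∑ i ∈ Finset.range a, X ^ (d * i) := by
  induction a with
  | zero => simp [qInt]
  | succ a ih =>
    rw [Finset.sum_range_succ, mul_add (qInt d), ← ih, Nat.mul_succ, qInt, Finset.sum_range_add,
      ← qInt]
    simp only [pow_add, ← Finset.mul_sum]
    rw [← qInt, mul_comm (qInt d)]

theorem exists_qFactorial_eq_pow_mul {ω : ℂ} {d : ℕ} (hω : IsPrimitiveRoot ω d) (hd : 2 ≤ d)
    (m : ℕ) : ∃ U : ℤ[X], qFactorial m = qInt d ^ (m / d) * U ∧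
      aeval ω U = (m / d).factorial * aeval ω (qFactorial (d - 1)) ^ (m / d) *
        aeval ω (qFactorial (m % d)) := by
  induction m with
  | zero => exact ⟨1, by simp [qFactorial_zero], by simp [qFactorial_zero]⟩
  | succ m ih =>
    obtain ⟨U, h1, h2⟩ := ih
    by_cases h : d ∣ m + 1
    · have hq : (m + 1) / d = m / d + 1 := by rw [Nat.succ_div, if_pos h]
      have hr : (m + 1) % d = 0 := Nat.mod_eq_zero_of_dvd h
      have hm : m + 1 = d * (m / d + 1) := by rw [← hq, Nat.mul_div_cancel' h]
      have hr' : m % d = d - 1 := by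
        have := Nat.div_add_mod m d
        rw [mul_add, mul_one] at hm
        omega
      refine ⟨U * ∑ i ∈ Finset.range (m / d + 1), X ^ (d * i), ?_, ?_⟩
      · rw [qFactorial_succ, h1, hq, hm, qInt_mul]
        ring
      · rw [map_mul, h2, hq, hr, hr', qFactorial_zero, Nat.factorial_succ]
        simp only [map_sum, map_pow, aeval_X, pow_mul, hω.pow_eq_one, one_pow, map_one,
          Finset.sum_const, Finset.card_range, nsmul_eq_mul]
        push_cast
        ring
    · have hq : (m + 1) / d = m / d := by rw [Nat.succ_div, if_neg h, add_zero]
      have hr : (m + 1) % d = m % d + 1 := by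
        have e1 := Nat.div_add_mod m d
        have e2 := Nat.div_add_mod (m + 1) d
        rw [hq] at e2
        omega
      refine ⟨U * qInt (m + 1), ?_, ?_⟩
      · rw [qFactorial_succ, h1, hq]
        ring
      · rw [map_mul, h2, hq, hr, qFactorial_succ, map_mul, aeval_qInt_mod hω hd (m + 1), hr]
        ring

/-- Cancelling the powers of `[d]_q` in the identity that defines `a_μ`. -/
theorem exists_factor_eq {n : ℕ} {μ : Fin n → ℕ} {P : ℤ[X]}
    (hP : qFactorial (n + ∑ i, μ i) = qFactorial (n + 1) * (∏ i, qFactorial (μ i)) * P)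
    {ω : ℂ} {d : ℕ} (hω : IsPrimitiveRoot ω d) (hd : 2 ≤ d) {a e : ℕ}
    (ha : (n + 1) / d + ∑ i, μ i / d = a) (he : (n + ∑ i, μ i) / d = a + e) :
    0 ^ e * ((((a + e).factorial : ℂ)) * aeval ω (qFactorial (d - 1)) ^ (a + e) *
      aeval ω (qFactorial ((n + ∑ i, μ i) % d))) =
    (((n + 1) / d).factorial * aeval ω (qFactorial ((n + 1) % d)) *
      ∏ i, (((μ i / d).factorial : ℂ) * aeval ω (qFactorial (μ i % d)))) *
      aeval ω (qFactorial (d - 1)) ^ a * aeval ω P := by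
  choose U hU hU' using exists_qFactorial_eq_pow_mul hω hd
  have hne : qInt d ≠ 0 := by
    intro h
    apply qFactorial_ne_zero d
    obtain ⟨c, rfl⟩ : ∃ c, d = c + 1 := ⟨d - 1, by omega⟩
    rw [qFactorial_succ, h, mul_zero]
  have key : qInt d ^ e * U (n + ∑ i, μ i) = U (n + 1) * (∏ i, U (μ i)) * P := by
    apply mul_left_cancel₀ (pow_ne_zero a hne)
    rw [← mul_assoc, ← pow_add, ← he, ← hU, hP, hU (n + 1),
      Finset.prod_congr rfl fun i _ => hU (μ i), Finset.prod_mul_distrib,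
      Finset.prod_pow_eq_pow_sum, ← ha, pow_add]
    ring
  have := congrArg (aeval ω) key
  simp only [map_mul, map_pow, map_prod, hU', aeval_qInt_self hω hd, he] at this
  rw [this, ← ha, pow_add, ← Finset.prod_pow_eq_pow_sum]
  simp only [Finset.prod_mul_distrib]
  ring

theorem aeval_eq_zero {n : ℕ} {μ : Fin n → ℕ} {P : ℤ[X]}
    (hP : qFactorial (n + ∑ i, μ i) = qFactorial (n + 1) * (∏ i, qFactorial (μ i)) * P)
    {ω : ℂ} {d : ℕ} (hω : IsPrimitiveRoot ω d) (hd : 2 ≤ d) (hdn : d ∣ n + 2)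
    (h : 2 ≤ ∑ i, μ i % d) : aeval ω P = 0 := by
  have h0 : 0 < d := by omega
  have h1 : ∑ i, μ i = d * (∑ i, μ i / d) + ∑ i, μ i % d := by
    rw [Finset.mul_sum, ← Finset.sum_add_distrib]
    exact Finset.sum_congr rfl fun i _ => (Nat.div_add_mod _ _).symm
  obtain ⟨m, hm⟩ := hdn
  obtain ⟨m, rfl⟩ : ∃ c, m = c + 1 := ⟨m - 1, by cases m <;> omega⟩
  rw [Nat.mul_succ] at hm
  have h2 : (n + 1) / d = m := by
    rw [show n + 1 = d * m + (d - 1) by omega, Nat.mul_add_div h0,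
      Nat.div_eq_of_lt (by omega), add_zero]
  have h3 : ∃ e, (n + ∑ i, μ i) / d = m + ∑ i, μ i / d + (e + 1) := by
    refine ⟨(∑ i, μ i % d - 2) / d, ?_⟩
    rw [show n + ∑ i, μ i = d * (m + ∑ i, μ i / d + 1) + (∑ i, μ i % d - 2) by
      rw [mul_add, mul_add]; omega, Nat.mul_add_div h0]
    ring
  obtain ⟨e, he⟩ := h3
  have := exists_factor_eq hP hω hd (by rw [h2]) he
  rw [zero_pow (Nat.succ_ne_zero e), zero_mul, eq_comm, mul_eq_zero] at this
  refine this.resolve_left ?_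
  have hr (x : ℕ) : aeval ω (qFactorial (x % d)) ≠ 0 :=
    aeval_qFactorial_ne_zero hω (Nat.mod_lt _ h0)
  refine mul_ne_zero (mul_ne_zero (mul_ne_zero (Nat.cast_ne_zero.2 (Nat.factorial_ne_zero _))
    (hr _)) (Finset.prod_ne_zero_iff.2 fun i _ =>
      mul_ne_zero (Nat.cast_ne_zero.2 (Nat.factorial_ne_zero _)) (hr _))) (pow_ne_zero _ ?_)
  exact aeval_qFactorial_ne_zero hω (by omega)

theorem aeval_mul_eq_factorial {n : ℕ} {μ : Fin n → ℕ} {P : ℤ[X]}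
    (hP : qFactorial (n + ∑ i, μ i) = qFactorial (n + 1) * (∏ i, qFactorial (μ i)) * P)
    {ω : ℂ} {d : ℕ} (hω : IsPrimitiveRoot ω d) (hd : 2 ≤ d) {m : ℕ} (hm : n + 2 = d * (m + 1))
    {ν δ : Fin n → ℕ} (hμ : ∀ i, μ i = d * ν i + δ i) (hδ : ∑ i, δ i ≤ 1)
    (hδd : d = 2 ∨ ∑ i, δ i = 1) :
    aeval ω P * (m.factorial * ∏ i, ((ν i).factorial : ℂ)) = ((m + ∑ i, ν i).factorial : ℂ) := by
  have h0 : 0 < d := by omega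
  have hδi (i : Fin n) : δ i ≤ 1 :=
    (Finset.single_le_sum (fun _ _ => Nat.zero_le _) (Finset.mem_univ i)).trans hδ
  have hdiv (i : Fin n) : μ i / d = ν i := by
    rw [hμ, Nat.mul_add_div h0, Nat.div_eq_of_lt (by have := hδi i; omega), add_zero]
  have hmod (i : Fin n) : μ i % d = δ i := by
    rw [hμ, Nat.mul_add_mod, Nat.mod_eq_of_lt (by have := hδi i; omega)]
  have hsum : ∑ i, μ i = d * ∑ i, ν i + ∑ i, δ i := by
    rw [Finset.mul_sum, ← Finset.sum_add_distrib]
    exact Finset.sum_congr rfl fun i _ => hμ i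
  rw [Nat.mul_succ] at hm
  have e1 : n + 1 = d * m + (d - 1) := by omega
  have e2 : n + ∑ i, μ i = d * (m + ∑ i, ν i) + (d - 2 + ∑ i, δ i) := by
    rw [mul_add]; omega
  have h1 : (n + 1) / d = m := by
    rw [e1, Nat.mul_add_div h0, Nat.div_eq_of_lt (by omega), add_zero]
  have h2 : (n + ∑ i, μ i) / d = m + ∑ i, ν i + 0 := by
    rw [e2, Nat.mul_add_div h0, Nat.div_eq_of_lt (by omega)]
  have h1' : (n + 1) % d = d - 1 := by
    rw [e1, Nat.mul_add_mod, Nat.mod_eq_of_lt (by omega)]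
  have h2' : (n + ∑ i, μ i) % d = d - 2 + ∑ i, δ i := by
    rw [e2, Nat.mul_add_mod, Nat.mod_eq_of_lt (by omega)]
  have hsmall (r : ℕ) (hr : r ≤ 1) : aeval ω (qFactorial r) = 1 := by
    interval_cases r <;> simp [qFactorial, qInt]
  have hlast : aeval ω (qFactorial (d - 2 + ∑ i, δ i)) = aeval ω (qFactorial (d - 1)) := by
    rcases hδd with rfl | h
    · rw [hsmall _ (by omega), hsmall _ (by omega)]
    · rw [h]; congr 2; omega
  have := exists_factor_eq hP hω hd (by rw [h1, Finset.sum_congr rfl fun i _ => hdiv i]) h2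
  simp only [hdiv, hmod, h1, h1', h2', hlast, add_zero, pow_zero, one_mul,
    fun i => hsmall (δ i) (hδi i), mul_one] at this
  have hV : aeval ω (qFactorial (d - 1)) ≠ 0 := aeval_qFactorial_ne_zero hω (by omega)
  apply mul_right_cancel₀ (mul_ne_zero (pow_ne_zero (m + ∑ i, ν i) hV) hV)
  linear_combination -this

theorem aeval_one_mul_eq_factorial {n : ℕ} {μ : Fin n → ℕ} {P : ℤ[X]}
    (hP : qFactorial (n + ∑ i, μ i) = qFactorial (n + 1) * (∏ i, qFactorial (μ i)) * P) :
    aeval (1 : ℂ) P * ((n + 1).factorial * ∏ i, ((μ i).factorial : ℂ)) =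
      ((n + ∑ i, μ i).factorial : ℂ) := by
  have h (m : ℕ) : aeval (1 : ℂ) (qFactorial m) = (m.factorial : ℂ) := by
    rw [qFactorial, map_prod, ← Finset.prod_range_add_one_eq_factorial, Nat.cast_prod]
    exact Finset.prod_congr rfl fun i _ => by simp [aeval_qInt]
  have := congrArg (aeval (1 : ℂ)) hP
  simp only [map_mul, map_prod, h] at this
  rw [this]
  ring

/-! ### Systems of non-crossing arcs on an interval -/

/-- A set of arcs `(a, b)` with `p ≤ a < a + 2 ≤ b ≤ m`, no two of which cross. -/
structure IsArcSystem (p m : ℕ) (A : Finset (ℕ × ℕ)) : Prop where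
  bounds : ∀ e ∈ A, p ≤ e.1 ∧ e.1 + 2 ≤ e.2 ∧ e.2 ≤ m
  noncrossing : ∀ e ∈ A, ∀ f ∈ A, ¬ (e.1 < f.1 ∧ f.1 < e.2 ∧ e.2 < f.2)

/-- The points of `[p, m]` that are not strictly below an arc. -/
def outer (p m : ℕ) (A : Finset (ℕ × ℕ)) : Finset ℕ :=
  {x ∈ Finset.Icc p m | ∀ f ∈ A, ¬ (f.1 < x ∧ x < f.2)}

/-- The vertices of the polygon directly below the arc `e`. -/
def under (A : Finset (ℕ × ℕ)) (e : ℕ × ℕ) : Finset ℕ :=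
  {x ∈ Finset.Icc e.1 e.2 | ∀ f ∈ A, f.1 < x ∧ x < f.2 → f.1 ≤ e.1 ∧ e.2 ≤ f.2}

/-- The number of arcs with a `j`-gon directly below. -/
def typeCount (A : Finset (ℕ × ℕ)) (j : ℕ) : ℕ := (A.filter fun e => (under A e).card = j).card

theorem mem_outer {p m x : ℕ} {A : Finset (ℕ × ℕ)} :
    x ∈ outer p m A ↔ (p ≤ x ∧ x ≤ m) ∧ ∀ f ∈ A, ¬ (f.1 < x ∧ x < f.2) := by
  simp [outer]

theorem mem_under {x : ℕ} {A : Finset (ℕ × ℕ)} {e : ℕ × ℕ} :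
    x ∈ under A e ↔
      (e.1 ≤ x ∧ x ≤ e.2) ∧ ∀ f ∈ A, f.1 < x ∧ x < f.2 → f.1 ≤ e.1 ∧ e.2 ≤ f.2 := by
  simp [under]

namespace IsArcSystem

variable {p m c : ℕ} {A : Finset (ℕ × ℕ)}

theorem left_mem_outer (hA : IsArcSystem p m A) (h : p ≤ m) : p ∈ outer p m A :=
  mem_outer.2 ⟨⟨le_rfl, h⟩, fun f hf => by have := hA.bounds f hf; omega⟩

theorem right_mem_outer (hA : IsArcSystem p m A) (h : p ≤ m) : m ∈ outer p m A :=
  mem_outer.2 ⟨⟨h, le_rfl⟩, fun f hf => by have := hA.bounds f hf; omega⟩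

theorem mono_left {q : ℕ} (hA : IsArcSystem p m A) (h : q ≤ p) : IsArcSystem q m A :=
  ⟨fun e he => by have := hA.bounds e he; omega, hA.noncrossing⟩

theorem of_succ_mem_outer (hA : IsArcSystem p m A) (h : p + 1 ∈ outer p m A) :
    IsArcSystem (p + 1) m A := by
  refine ⟨fun e he => ?_, hA.noncrossing⟩
  have h1 := hA.bounds e he
  have h2 := (mem_outer.1 h).2 e he
  omega

theorem outer_succ (hA : IsArcSystem (p + 1) m A) (h : p + 1 ≤ m) :
    outer p m A = insert p (outer (p + 1) m A) := by
  ext x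
  simp only [Finset.mem_insert, mem_outer]
  constructor
  · rintro ⟨h1, h2⟩
    by_cases hx : x = p
    · exact Or.inl hx
    · exact Or.inr ⟨by omega, h2⟩
  · rintro (rfl | ⟨h1, h2⟩)
    · exact ⟨by omega, fun f hf => by have := hA.bounds f hf; omega⟩
    · exact ⟨by omega, h2⟩

theorem card_outer_succ (hA : IsArcSystem (p + 1) m A) (h : p + 1 ≤ m) :
    (outer p m A).card = (outer (p + 1) m A).card + 1 := by
  rw [hA.outer_succ h, Finset.card_insert_of_notMem]
  rw [mem_outer]
  omega

/-! #### Adding an arc above the first points -/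

theorem _root_.PolygonDissection.lt_of_mem_outer (hc : c ∈ outer p m A) (hpc : p < c)
    (hn : (p, c) ∉ A) {y : ℕ} (hy : (p, y) ∈ A) : y < c := by
  have := (mem_outer.1 hc).2 _ hy
  have : y ≠ c := by rintro rfl; exact hn hy
  simp only at *
  omega

theorem insert_arc (hA : IsArcSystem p m A) (hc : c ∈ outer p m A) (hpc : p + 2 ≤ c) :
    IsArcSystem p m (insert (p, c) A) := by
  have hc' := mem_outer.1 hc
  constructor
  · intro e he
    rcases Finset.mem_insert.1 he with rfl | he
    · exact ⟨le_rfl, hpc, hc'.1.2⟩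
    · exact hA.bounds e he
  · intro e he f hf
    rcases Finset.mem_insert.1 he with rfl | he <;> rcases Finset.mem_insert.1 hf with rfl | hf
    · simp
    · have := hc'.2 f hf
      simp only
      omega
    · have := hA.bounds e he
      simp only
      omega
    · exact hA.noncrossing e he f hf

theorem under_insert_self (hA : IsArcSystem p m A) (hc : c ∈ outer p m A)
    (hn : (p, c) ∉ A) : under (insert (p, c) A) (p, c) = (outer p m A).filter (· ≤ c) := by
  have hc' := mem_outer.1 hc
  ext x
  simp only [mem_under, Finset.mem_filter, mem_outer, Finset.mem_insert, forall_eq_or_imp]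
  constructor
  · rintro ⟨h1, -, h2⟩
    refine ⟨⟨by omega, fun f hf hx => ?_⟩, h1.2⟩
    have h3 := h2 f hf hx
    have h4 := hc'.2 f hf
    have h5 := hA.bounds f hf
    have : f = (p, c) := Prod.ext (by simp only; omega) (by simp only; omega)
    exact hn (this ▸ hf)
  · rintro ⟨⟨h1, h2⟩, h3⟩
    exact ⟨by omega, fun _ => ⟨le_rfl, le_rfl⟩, fun f hf hx => absurd hx (h2 f hf)⟩

theorem under_insert_of_mem (hA : IsArcSystem p m A) (hc : c ∈ outer p m A) {e : ℕ × ℕ}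
    (he : e ∈ A) : under (insert (p, c) A) e = under A e := by
  have hc' := mem_outer.1 hc
  ext x
  simp only [mem_under, Finset.mem_insert, forall_eq_or_imp]
  have h1 := hc'.2 e he
  have h2 := hA.bounds e he
  constructor
  · rintro ⟨h3, -, h4⟩
    exact ⟨h3, h4⟩
  · rintro ⟨h3, h4⟩
    exact ⟨h3, by omega, h4⟩

theorem _root_.PolygonDissection.outer_insert :
    outer p m (insert (p, c) A) = (outer p m A).filter fun x => x = p ∨ c ≤ x := by
  ext x
  simp only [Finset.mem_filter, mem_outer, Finset.mem_insert, forall_eq_or_imp]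
  constructor
  · rintro ⟨h1, h2, h3⟩
    exact ⟨⟨h1, h3⟩, by omega⟩
  · rintro ⟨⟨h1, h3⟩, h2⟩
    exact ⟨h1, by omega, h3⟩

theorem card_outer_insert (hA : IsArcSystem p m A) (hc : c ∈ outer p m A) (hpc : p < c)
    (hn : (p, c) ∉ A) : (outer p m (insert (p, c) A)).card +
      (under (insert (p, c) A) (p, c)).card = (outer p m A).card + 2 := by
  have hc' := mem_outer.1 hc
  rw [outer_insert, hA.under_insert_self hc hn, ← Finset.card_union_add_card_inter]
  congr 1
  · congr 1
    ext x
    simp only [Finset.mem_union, Finset.mem_filter]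
    constructor
    · rintro (h | h) <;> exact h.1
    · intro h
      rcases le_total x c with h1 | h1
      · exact Or.inr ⟨h, h1⟩
      · exact Or.inl ⟨h, Or.inr h1⟩
  · rw [← Finset.card_pair hpc.ne]
    congr 1
    ext x
    simp only [Finset.mem_inter, Finset.mem_filter, Finset.mem_insert, Finset.mem_singleton]
    constructor
    · rintro ⟨⟨-, h1⟩, -, h2⟩
      omega
    · rintro (rfl | rfl)
      · have := hA.left_mem_outer (by omega)
        exact ⟨⟨this, Or.inl rfl⟩, this, hpc.le⟩
      · exact ⟨⟨hc, Or.inr le_rfl⟩, hc, le_rfl⟩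

theorem typeCount_insert (hA : IsArcSystem p m A) (hc : c ∈ outer p m A)
    (hn : (p, c) ∉ A) (j : ℕ) : typeCount (insert (p, c) A) j =
      typeCount A j + if (under (insert (p, c) A) (p, c)).card = j then 1 else 0 := by
  have h : A.filter (fun e => (under (insert (p, c) A) e).card = j) =
      A.filter fun e => (under A e).card = j :=
    Finset.filter_congr fun e he => by rw [hA.under_insert_of_mem hc he]
  rw [typeCount, Finset.filter_insert, h, typeCount]
  split_ifs
  · rw [Finset.card_insert_of_notMem fun h => hn (Finset.mem_filter.1 h).1]
  · rfl

/-! #### The longest arc from the left end -/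

/-- The right end of the longest arc that starts at `p`. -/
def _root_.PolygonDissection.topEnd (p : ℕ) (A : Finset (ℕ × ℕ)) : ℕ :=
  (A.filter (·.1 = p)).sup Prod.snd

theorem le_topEnd {y : ℕ} (h : (p, y) ∈ A) : y ≤ topEnd p A := by
  have : (p, y) ∈ A.filter (·.1 = p) := Finset.mem_filter.2 ⟨h, rfl⟩
  exact Finset.le_sup (f := Prod.snd) this

theorem topEnd_insert (h : ∀ y, (p, y) ∈ A → y < c) : topEnd p (insert (p, c) A) = c := by
  refine le_antisymm (Finset.sup_le fun e he => ?_) (le_topEnd (Finset.mem_insert_self _ _))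
  obtain ⟨a, b⟩ := e
  obtain ⟨h1, h2⟩ := Finset.mem_filter.1 he
  simp only at h2
  subst h2
  rcases Finset.mem_insert.1 h1 with h3 | h3
  · exact (Prod.ext_iff.1 h3).2.le
  · exact (h b h3).le

theorem topEnd_mem (hA : IsArcSystem p m A) (hpm : p < m) (h : p + 1 ∉ outer p m A) :
    (p, topEnd p A) ∈ A := by
  obtain ⟨f, hf, hx⟩ : ∃ f ∈ A, f.1 < p + 1 ∧ p + 1 < f.2 := by
    by_contra! hcon
    exact h (mem_outer.2 ⟨by omega, fun f hf hx => absurd hx.2 (by have := hcon f hf hx.1; omega)⟩)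
  have h1 := hA.bounds f hf
  obtain ⟨e, he, hs⟩ := Finset.exists_mem_eq_sup (A.filter (·.1 = p))
    ⟨f, Finset.mem_filter.2 ⟨hf, by omega⟩⟩ Prod.snd
  obtain ⟨h2, h3⟩ := Finset.mem_filter.1 he
  rw [topEnd, hs, ← h3]
  exact h2

theorem topEnd_mem_outer_erase (hA : IsArcSystem p m A) (h : (p, topEnd p A) ∈ A) :
    topEnd p A ∈ outer p m (A.erase (p, topEnd p A)) := by
  have hb := hA.bounds _ h
  refine mem_outer.2 ⟨by simp only at hb; omega, fun f hf hx => ?_⟩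
  have hf' := Finset.mem_of_mem_erase hf
  have h1 := hA.bounds f hf'
  have h2 := hA.noncrossing _ h _ hf'
  simp only at h2
  obtain ⟨a, b⟩ := f
  have h3 : a = p := by simp only at *; omega
  subst h3
  have := le_topEnd hf'
  simp only at hx
  omega

theorem subset {B : Finset (ℕ × ℕ)} (hA : IsArcSystem p m A) (h : B ⊆ A) : IsArcSystem p m B :=
  ⟨fun e he => hA.bounds e (h he), fun e he f hf => hA.noncrossing e (h he) f (h hf)⟩

theorem exists_first (hA : IsArcSystem p m A) (hpm : p < m) :
    ∃ y ∈ outer p m A, p < y ∧ (y = p + 1 ∨ (p, y) ∈ A) := by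
  by_cases h : p + 1 ∈ outer p m A
  · exact ⟨p + 1, h, by omega, Or.inl rfl⟩
  · have h1 := hA.topEnd_mem hpm h
    have h2 := hA.bounds _ h1
    have h3 := mem_outer.1 (hA.topEnd_mem_outer_erase h1)
    simp only at h2
    refine ⟨topEnd p A, mem_outer.2 ⟨h3.1, fun f hf => ?_⟩, by omega, Or.inr h1⟩
    by_cases hfe : f = (p, topEnd p A)
    · rw [hfe]; simp
    · exact h3.2 f (Finset.mem_erase.2 ⟨hfe, hf⟩)

theorem three_le_card_under (hA : IsArcSystem p m A) (hc : c ∈ outer p m A) (hpc : p + 2 ≤ c)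
    (hn : (p, c) ∉ A) : 3 ≤ (under (insert (p, c) A) (p, c)).card := by
  have hc' := mem_outer.1 hc
  rw [hA.under_insert_self hc hn]
  obtain ⟨y, hy, hpy, h⟩ := hA.exists_first (by omega)
  have hyc : y < c := by
    rcases h with rfl | h
    · omega
    · exact lt_of_mem_outer hc (by omega) hn h
  have hsub : ({p, y, c} : Finset ℕ) ⊆ (outer p m A).filter (· ≤ c) := by
    intro x hx
    simp only [Finset.mem_insert, Finset.mem_singleton] at hx
    rcases hx with rfl | rfl | rfl
    · exact Finset.mem_filter.2 ⟨hA.left_mem_outer (by omega), by omega⟩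
    · exact Finset.mem_filter.2 ⟨hy, hyc.le⟩
    · exact Finset.mem_filter.2 ⟨hc, le_rfl⟩
  refine le_trans (le_of_eq ?_) (Finset.card_le_card hsub)
  rw [Finset.card_insert_of_notMem, Finset.card_pair hyc.ne]
  simp only [Finset.mem_insert, Finset.mem_singleton]
  omega

end IsArcSystem

theorem exists_card_filter_le_eq (O : Finset ℕ) {t : ℕ} (h0 : 0 < t) (ht : t ≤ O.card) :
    ∃ c ∈ O, (O.filter (· ≤ c)).card = t := by
  induction O using Finset.induction_on_max with
  | empty => simp at ht; omega
  | insert a s hs ih =>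
    have ha : a ∉ s := fun h => (hs a h).false
    rw [Finset.card_insert_of_notMem ha] at ht
    by_cases h : t ≤ s.card
    · obtain ⟨c, hc, h1⟩ := ih h
      refine ⟨c, Finset.mem_insert_of_mem hc, ?_⟩
      rw [Finset.filter_insert, if_neg (not_le.2 (hs c hc)), h1]
    · refine ⟨a, Finset.mem_insert_self _ _, ?_⟩
      rw [Finset.filter_true_of_mem, Finset.card_insert_of_notMem ha]
      · omega
      · intro x hx
        rcases Finset.mem_insert.1 hx with rfl | hx
        · exact le_rfl
        · exact (hs x hx).le

theorem eq_of_card_filter_le_eq {O : Finset ℕ} {a b : ℕ} (ha : a ∈ O) (hb : b ∈ O)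
    (h : (O.filter (· ≤ a)).card = (O.filter (· ≤ b)).card) : a = b := by
  by_contra hne
  wlog hab : a < b generalizing a b
  · exact this hb ha h.symm (Ne.symm hne) (by omega)
  refine h.not_lt (Finset.card_lt_card ⟨fun x hx => ?_, fun hsub => ?_⟩)
  · obtain ⟨h1, h2⟩ := Finset.mem_filter.1 hx
    exact Finset.mem_filter.2 ⟨h1, by omega⟩
  · have := (Finset.mem_filter.1 (hsub (Finset.mem_filter.2 ⟨hb, le_rfl⟩))).2
    omega

/-! ### Counting arc systems by type -/

open Classical in
/-- The arc systems on `[p, m]` with `s + 1` outer points and with `μ i` arcs directly above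
an `(i + 3)`-gon. -/
noncomputable def arcSystems {n : ℕ} (p m s : ℕ) (μ : Fin n → ℕ) : Finset (Finset (ℕ × ℕ)) :=
  {A ∈ (Finset.Icc p m ×ˢ Finset.Icc p m).powerset | IsArcSystem p m A ∧
    (outer p m A).card = s + 1 ∧ ∀ i : Fin n, typeCount A ((i : ℕ) + 3) = μ i}

theorem mem_arcSystems {n : ℕ} {p m s : ℕ} {μ : Fin n → ℕ} {A : Finset (ℕ × ℕ)} :
    A ∈ arcSystems p m s μ ↔ IsArcSystem p m A ∧
      (outer p m A).card = s + 1 ∧ ∀ i : Fin n, typeCount A ((i : ℕ) + 3) = μ i := by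
  simp only [arcSystems, Finset.mem_filter, and_iff_right_iff_imp, Finset.mem_powerset]
  rintro ⟨hA, -⟩ e he
  have := hA.bounds e he
  simp only [Finset.mem_product, Finset.mem_Icc]
  omega

theorem arcSystems_filter_succ_mem {n : ℕ} {p m s : ℕ} (μ : Fin n → ℕ) (hpm : p + 1 ≤ m) :
    (arcSystems p m (s + 1) μ).filter (fun A => p + 1 ∈ outer p m A) =
      arcSystems (p + 1) m s μ := by
  ext A
  rw [Finset.mem_filter, mem_arcSystems, mem_arcSystems]
  constructor
  · rintro ⟨⟨h1, h2, h3⟩, h4⟩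
    have h5 := h1.of_succ_mem_outer h4
    rw [h5.card_outer_succ hpm] at h2
    exact ⟨h5, by omega, h3⟩
  · rintro ⟨h1, h2, h3⟩
    refine ⟨⟨h1.mono_left (by omega), ?_, h3⟩, ?_⟩
    · rw [h1.card_outer_succ hpm, h2]
    · rw [h1.outer_succ hpm]
      exact Finset.mem_insert_of_mem (h1.left_mem_outer hpm)

theorem card_arcSystems_filter_under {n : ℕ} {p m s : ℕ} {μ ν : Fin n → ℕ} (hpm : p < m)
    (hs : 0 < s) (i : Fin n) (hμ : μ = ν + Pi.single i 1) :
    ((arcSystems p m s μ).filter (fun A => p + 1 ∉ outer p m A ∧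
      (under A (p, topEnd p A)).card = (i : ℕ) + 3)).card =
    (arcSystems p m (s + (i + 1)) ν).card := by
  have hsingle (j : Fin n) : μ j = ν j + if (i : ℕ) + 3 = (j : ℕ) + 3 then 1 else 0 := by
    rw [hμ, Pi.add_apply, Pi.single_apply]
    simp only [Nat.add_right_cancel_iff, ← Fin.ext_iff, eq_comm]
  have key (A) (hA : A ∈ (arcSystems p m s μ).filter (fun A => p + 1 ∉ outer p m A ∧
      (under A (p, topEnd p A)).card = (i : ℕ) + 3)) :
      (p, topEnd p A) ∈ A ∧ IsArcSystem p m (A.erase (p, topEnd p A)) ∧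
      topEnd p A ∈ outer p m (A.erase (p, topEnd p A)) ∧ p + 2 ≤ topEnd p A ∧
      insert (p, topEnd p A) (A.erase (p, topEnd p A)) = A := by
    obtain ⟨h1, h2, h3⟩ := Finset.mem_filter.1 hA
    obtain ⟨h4, h5, h6⟩ := mem_arcSystems.1 h1
    have h7 := h4.topEnd_mem hpm h2
    exact ⟨h7, h4.subset (Finset.erase_subset _ _), h4.topEnd_mem_outer_erase h7,
      (h4.bounds _ h7).2.1, Finset.insert_erase h7⟩
  refine Finset.card_bij (fun A _ => A.erase (p, topEnd p A)) ?_ ?_ ?_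
  · intro A hA
    obtain ⟨k1, k2, k3, k4, k5⟩ := key A hA
    obtain ⟨h1, h2, h3⟩ := Finset.mem_filter.1 hA
    obtain ⟨h4, h5, h6⟩ := mem_arcSystems.1 h1
    have hn : (p, topEnd p A) ∉ A.erase (p, topEnd p A) := Finset.notMem_erase _ _
    refine mem_arcSystems.2 ⟨k2, ?_, fun j => ?_⟩
    · have := k2.card_outer_insert k3 (by omega) hn
      rw [k5, h5, h3] at this
      omega
    · have := k2.typeCount_insert k3 hn ((j : ℕ) + 3)
      rw [k5, h6, h3, hsingle] at this
      omega
  · intro A hA B hB hAB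
    obtain ⟨k1, k2, k3, k4, k5⟩ := key A hA
    obtain ⟨l1, l2, l3, l4, l5⟩ := key B hB
    have hA3 := (Finset.mem_filter.1 hA).2.2
    have hB3 := (Finset.mem_filter.1 hB).2.2
    have e1 := k2.under_insert_self k3 (Finset.notMem_erase _ _)
    have e2 := l2.under_insert_self l3 (Finset.notMem_erase _ _)
    rw [k5] at e1
    rw [l5] at e2
    rw [e1] at hA3
    rw [e2] at hB3
    have : topEnd p A = topEnd p B := by
      rw [hAB] at k3 hA3
      exact eq_of_card_filter_le_eq k3 l3 (hA3.trans hB3.symm)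
    rw [← k5, ← l5, hAB, this]
  · intro A hA
    obtain ⟨h1, h2, h3⟩ := mem_arcSystems.1 hA
    obtain ⟨c, hc, hcard⟩ := exists_card_filter_le_eq (outer p m A)
      (t := (i : ℕ) + 3) (by omega) (by omega)
    have hc' := mem_outer.1 hc
    have hpc : p + 2 ≤ c := by
      have hsub : (outer p m A).filter (· ≤ c) ⊆ Finset.Icc p c := fun x hx => by
        obtain ⟨h4, h5⟩ := Finset.mem_filter.1 hx
        exact Finset.mem_Icc.2 ⟨(mem_outer.1 h4).1.1, h5⟩
      have := Finset.card_le_card hsub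
      rw [Nat.card_Icc] at this
      omega
    have hn : (p, c) ∉ A := by
      intro h
      have hsub : (outer p m A).filter (· ≤ c) ⊆ {p, c} := fun x hx => by
        obtain ⟨h4, h5⟩ := Finset.mem_filter.1 hx
        obtain ⟨h6, h7⟩ := mem_outer.1 h4
        have := h7 _ h
        simp only [Finset.mem_insert, Finset.mem_singleton]
        simp only at this
        omega
      have := Finset.card_le_card hsub
      have := Finset.card_le_two (a := p) (b := c)
      omega
    have htop := IsArcSystem.topEnd_insert fun y hy => lt_of_mem_outer hc (by omega) hn hy
    have hu : (under (insert (p, c) A) (p, c)).card = i + 3 := by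
      rw [h1.under_insert_self hc hn, hcard]
    refine ⟨insert (p, c) A, Finset.mem_filter.2 ⟨mem_arcSystems.2
      ⟨h1.insert_arc hc hpc, ?_, fun j => ?_⟩, ?_, ?_⟩, ?_⟩
    · have := h1.card_outer_insert hc (by omega) hn
      omega
    · rw [h1.typeCount_insert hc hn, h3, hu, hsingle]
    · intro h
      have := (mem_outer.1 h).2 _ (Finset.mem_insert_self _ _)
      simp only at this
      omega
    · rw [htop, hu]
    · simp only [htop]
      exact Finset.erase_insert hn

theorem card_arcSystems_succ {n : ℕ} {p m s : ℕ} (μ : Fin n → ℕ) (hpm : p < m)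
    (hmn : m ≤ p + n + 1) :
    (arcSystems p m (s + 1) μ).card = (arcSystems (p + 1) m s μ).card +
      ∑ i : Fin n, if μ i = 0 then 0 else
        (arcSystems p m (s + 1 + (i + 1)) (μ - Pi.single i 1)).card := by
  rw [← Finset.card_filter_add_card_filter_not (fun A => p + 1 ∈ outer p m A),
    arcSystems_filter_succ_mem μ hpm]
  congr 1
  have hmaps : ∀ A ∈ (arcSystems p m (s + 1) μ).filter (fun A => p + 1 ∉ outer p m A),
      (under A (p, topEnd p A)).card ∈
        (Finset.univ : Finset (Fin n)).map (Fin.valEmbedding.trans (addRightEmbedding 3)) := by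
    intro A hA
    obtain ⟨h1, h2⟩ := Finset.mem_filter.1 hA
    obtain ⟨h4, h5, h6⟩ := mem_arcSystems.1 h1
    have h7 := h4.topEnd_mem hpm h2
    have h8 := h4.bounds _ h7
    have h9 := (h4.subset (Finset.erase_subset _ _)).three_le_card_under
      (h4.topEnd_mem_outer_erase h7) h8.2.1 (Finset.notMem_erase _ _)
    rw [Finset.insert_erase h7] at h9
    have hle : (under A (p, topEnd p A)).card ≤ topEnd p A + 1 - p :=
      (Finset.card_filter_le _ _).trans (by rw [Nat.card_Icc])
    simp only at h8
    simp only [Finset.mem_map, Finset.mem_univ, true_and, Function.Embedding.trans_apply,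
      Fin.valEmbedding_apply, addRightEmbedding_apply]
    exact ⟨⟨(under A (p, topEnd p A)).card - 3, by omega⟩, by simp only; omega⟩
  rw [Finset.card_eq_sum_card_fiberwise hmaps, Finset.sum_map]
  refine Finset.sum_congr rfl fun i _ => ?_
  simp only [Function.Embedding.trans_apply, Fin.valEmbedding_apply, addRightEmbedding_apply,
    Finset.filter_filter]
  split_ifs with h
  · rw [Finset.card_eq_zero, Finset.filter_eq_empty_iff]
    rintro A hA ⟨h2, h3⟩
    obtain ⟨h4, h5, h6⟩ := mem_arcSystems.1 hA
    have h7 := h6 i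
    rw [h, typeCount, Finset.card_eq_zero, Finset.filter_eq_empty_iff] at h7
    exact h7 (h4.topEnd_mem hpm h2) h3
  · refine card_arcSystems_filter_under hpm (Nat.succ_pos s) i ?_
    ext j
    rw [Pi.add_apply, Pi.sub_apply, Pi.single_apply]
    split_ifs with hj
    · subst hj; omega
    · omega

theorem arcSystems_zero {n : ℕ} {p m : ℕ} (μ : Fin n → ℕ) (hpm : p < m) :
    arcSystems p m 0 μ = ∅ := by
  refine Finset.eq_empty_of_forall_notMem fun A hA => ?_
  obtain ⟨h1, h2, -⟩ := mem_arcSystems.1 hA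
  have := Finset.card_le_one.1 h2.le p (h1.left_mem_outer hpm.le) m (h1.right_mem_outer hpm.le)
  omega

theorem arcSystems_one (n p : ℕ) :
    arcSystems p (p + 1) 1 (0 : Fin n → ℕ) = {∅} := by
  ext A
  rw [Finset.mem_singleton, mem_arcSystems]
  constructor
  · rintro ⟨h, -⟩
    refine Finset.eq_empty_of_forall_notMem fun e he => ?_
    have := h.bounds e he
    omega
  · rintro rfl
    refine ⟨⟨by simp, by simp⟩, ?_, fun i => rfl⟩
    simp [outer]
    omega

theorem card_arcSystems {n : ℕ} (p L s : ℕ) (μ : Fin n → ℕ) (hL : L ≤ n)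
    (hμ : ∑ i : Fin n, ((i : ℕ) + 1) * μ i + s = L + 1) :
    (arcSystems p (p + L + 1) s μ).card * ((L + 1).factorial * ∏ i, (μ i).factorial) =
      s * (L + ∑ i, μ i).factorial := by
  induction hk : L + ∑ i, μ i generalizing p L s μ with
  | zero =>
    have hL0 : L = 0 := by omega
    have hμ0 : μ = 0 := by
      ext i
      exact Finset.sum_eq_zero_iff.1 (show ∑ i, μ i = 0 by omega) i (Finset.mem_univ i)
    subst hL0 hμ0
    obtain rfl : s = 1 := by simpa using hμ
    rw [add_zero, arcSystems_one]
    simp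
  | succ k ih =>
    rcases s with _ | s
    · rw [arcSystems_zero μ (by omega)]
      simp
    have hterm (i : Fin n) : (if μ i = 0 then 0 else
        (arcSystems p (p + L + 1) (s + 1 + (i + 1)) (μ - Pi.single i 1)).card) *
        ((L + 1).factorial * ∏ i, (μ i).factorial) =
        (s + 1 + (i + 1)) * μ i * k.factorial := by
      split_ifs with h
      · simp [h]
      · set ν := μ - Pi.single i 1 with hν
        have hνj (j) : μ j = ν j + if j = i then 1 else 0 := by
          rw [hν, Pi.sub_apply, Pi.single_apply]
          split_ifs with hj
          · subst hj; omega
          · omega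
        have hs1 : ∑ j, μ j = ∑ j, ν j + 1 := by
          rw [Finset.sum_congr rfl fun j _ => hνj j, Finset.sum_add_distrib]
          simp
        have hs2 : ∑ j : Fin n, ((j : ℕ) + 1) * μ j = ∑ j : Fin n, ((j : ℕ) + 1) * ν j + (i + 1) := by
          rw [Finset.sum_congr rfl fun j _ => by rw [hνj j, mul_add], Finset.sum_add_distrib]
          simp
        have hprod : ∏ j, (μ j).factorial = μ i * ∏ j, (ν j).factorial := by
          rw [← Finset.mul_prod_erase _ _ (Finset.mem_univ i),
            ← Finset.mul_prod_erase _ (fun j => (ν j).factorial) (Finset.mem_univ i),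
            ← mul_assoc]
          congr 1
          · rw [hνj i, if_pos rfl, Nat.factorial_succ]
          · refine Finset.prod_congr rfl fun j hj => ?_
            rw [hνj j, if_neg (Finset.ne_of_mem_erase hj), add_zero]
        have := ih p L (s + 1 + (i + 1)) ν hL (by omega) (by omega)
        rw [hprod]
        linear_combination μ i * this
    rcases L with _ | L
    · exfalso
      have : ∑ i : Fin n, ((i : ℕ) + 1) * μ i = 0 := by omega
      have : ∑ i, μ i = 0 := Finset.sum_eq_zero fun i hi => by
        simpa using Finset.sum_eq_zero_iff.1 this i hi
      omega
    have hfirst : (arcSystems (p + 1) (p + (L + 1) + 1) s μ).card *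
        ((L + 1).factorial * ∏ i, (μ i).factorial) = s * k.factorial := by
      have := ih (p + 1) L s μ (by omega) (by omega) (by omega)
      rwa [show p + 1 + L + 1 = p + (L + 1) + 1 by ring] at this
    rw [card_arcSystems_succ μ (by omega) (by omega), add_mul, Finset.sum_mul,
      Finset.sum_congr rfl fun i _ => hterm i, ← Finset.sum_mul, Nat.factorial_succ (L + 1),
      Nat.factorial_succ k]
    have hsum : ∑ i : Fin n, (s + 1 + (i + 1)) * μ i =
        (s + 1) * ∑ i, μ i + ∑ i : Fin n, ((i : ℕ) + 1) * μ i := by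
      rw [Finset.mul_sum, ← Finset.sum_add_distrib]
      exact Finset.sum_congr rfl fun i _ => by ring
    rw [hsum]
    have e1 : ∑ i, μ i + L = k := by omega
    zify at hμ e1 hfirst ⊢
    linear_combination ((L : ℤ) + 1 + 1) * hfirst + (k.factorial : ℤ) * hμ +
      ((s : ℤ) + 1) * k.factorial * e1

/-! ### Distances on the circle -/

section Circle

variable {N : ℕ}

theorem dist_self (o : ZMod N) : (o - o).val = 0 := by rw [sub_self, ZMod.val_zero]

theorem dist_eq_one (h : 2 ≤ N) {a b : ZMod N} (hab : b - a = 1) : (b - a).val = 1 := by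
  have : Fact (1 < N) := ⟨h⟩
  rw [hab, ZMod.val_one]

variable [NeZero N]

/-- The clockwise distance from `a` to `b` in terms of the positions relative to `o`. -/
theorem dist_cases (o a b : ZMod N) : (a - o).val < N ∧ (b - o).val < N ∧
    ((a - o).val ≤ (b - o).val ∧ (b - a).val + (a - o).val = (b - o).val ∨
      (b - o).val < (a - o).val ∧ (b - a).val + (a - o).val = (b - o).val + N) := by
  have ha := ZMod.val_lt (a - o)
  have hb := ZMod.val_lt (b - o)
  have hd := ZMod.val_lt (b - a)
  refine ⟨ha, hb, ?_⟩
  have h := ZMod.val_add (b - a) (a - o)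
  rw [sub_add_sub_cancel] at h
  rcases Nat.lt_or_ge ((b - a).val + (a - o).val) N with h1 | h1
  · rw [Nat.mod_eq_of_lt h1] at h
    omega
  · rw [Nat.mod_eq_sub_mod h1, Nat.mod_eq_of_lt (by omega)] at h
    omega

theorem eq_of_dist_eq (o : ZMod N) {a b : ZMod N} (h : (a - o).val = (b - o).val) : a = b :=
  sub_left_injective (ZMod.val_injective N h)

theorem dist_ne (o : ZMod N) {a b : ZMod N} (h : a ≠ b) : (a - o).val ≠ (b - o).val :=
  fun h' => h (eq_of_dist_eq o h')

theorem sub_eq_one_of_dist (h : 2 ≤ N) {a b : ZMod N} (hab : (b - a).val = 1) : b - a = 1 := by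
  have : Fact (1 < N) := ⟨h⟩
  exact ZMod.val_injective N (by rw [hab, ZMod.val_one])

/-! ### Consecutive vertices of an inscribed polygon -/

theorem exists_isNext_between {S : Finset (ZMod N)} (hS : 2 ≤ S.card) {c : ZMod N} (hc : c ∉ S) :
    ∃ p q, IsNext S p q ∧ Between p c q := by
  have hne : S.Nonempty := Finset.card_pos.1 (by omega)
  obtain ⟨p, hp, hp'⟩ := S.exists_max_image (fun x => (x - c).val) hne
  obtain ⟨q, hq, hq'⟩ := S.exists_min_image (fun x => (x - c).val) hne
  have hpq : p ≠ q := by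
    rintro rfl
    have : S ⊆ {p} := fun x hx => Finset.mem_singleton.2
      (eq_of_dist_eq c (le_antisymm (hp' x hx) (hq' x hx)))
    have := Finset.card_le_card this
    rw [Finset.card_singleton] at this
    omega
  have hqc : q ≠ c := fun h => hc (h ▸ hq)
  have h1 := dist_ne c hpq
  have h2 := dist_ne c hqc
  have h3 := hp' q hq
  have h4 := dist_cases c p q
  have h5 := dist_cases c p c
  rw [dist_self] at *
  simp only [IsNext, Between]
  refine ⟨p, q, ⟨hp, hq, hpq, fun s hs => ?_⟩, ?_⟩
  · have h6 := hp' s hs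
    have h7 := hq' s hs
    have h8 := dist_cases c p s
    omega
  · omega

theorem IsNext.exists_farther {S : Finset (ZMod N)} (hS : 3 ≤ S.card) {p q : ZMod N}
    (h : IsNext S p q) : ∃ r ∈ S, r ≠ p ∧ r ≠ q ∧ (q - p).val < (r - p).val := by
  obtain ⟨r, hr⟩ : ((S.erase p).erase q).Nonempty := by
    rw [← Finset.card_pos]
    have := Finset.pred_card_le_card_erase (s := S) (a := p)
    have := Finset.pred_card_le_card_erase (s := S.erase p) (a := q)
    omega
  obtain ⟨h1, h2⟩ := Finset.mem_erase.1 hr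
  obtain ⟨h3, h4⟩ := Finset.mem_erase.1 h2
  refine ⟨r, h4, h3, h1, ?_⟩
  have h5 := h.2.2.2 r h4
  have h6 := dist_ne p h3
  have h7 := dist_ne p h1
  rw [dist_self] at h6
  simp only [Between] at h5
  omega

theorem IsNext.dist_le {S : Finset (ZMod N)} {p q : ZMod N}
    (h : IsNext S p q) {r : ZMod N} (hr : r ∈ S) (hrp : r ≠ p) :
    (q - p).val ≤ (r - p).val := by
  have h1 := h.2.2.2 r hr
  have h2 := dist_ne p hrp
  rw [dist_self] at h2
  simp only [Between] at h1
  omega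

theorem IsNext.right_unique {S : Finset (ZMod N)} {p q r : ZMod N}
    (hq : IsNext S p q) (hr : IsNext S p r) : q = r :=
  eq_of_dist_eq p (le_antisymm (hq.dist_le hr.2.1 hr.2.2.1.symm)
    (hr.dist_le hq.2.1 hq.2.2.1.symm))

theorem IsSubgon.isNext_edge {T : Finset (Sym2 (ZMod N))} {S : Finset (ZMod N)}
    (hS : IsSubgon T S) {p q : ZMod N} (h : IsNext S p q) : q - p = 1 ∨ s(p, q) ∈ T := by
  rcases hS.boundary p q h with (h1 | h1) | h1
  · exact Or.inl h1
  · exfalso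
    obtain ⟨r, hr, hrp, hrq, hlt⟩ := h.exists_farther hS.three_le_card
    have hN : 2 ≤ N := by
      have := (Finset.card_le_univ S).trans_eq (ZMod.card N)
      have := hS.three_le_card
      omega
    have h2 := dist_eq_one hN h1
    have h3 := dist_cases p q p
    have h4 := dist_cases p q r
    rw [dist_self] at *
    omega
  · exact Or.inr h1

end Circle

/-! ### Subgons of a dissection with oriented diagonals -/

/-- A set `E` of directed arcs on the circle that orients the diagonals in `T` in such a way that
any two arcs are nested or have disjoint interiors. An arc that is not a diagonal may run once
around the circle except for one side. -/
structure IsOrientation {N : ℕ} (T : Finset (Sym2 (ZMod N))) (E : Finset (ZMod N × ZMod N)) :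
    Prop where
  two_le : ∀ e ∈ E, 2 ≤ (e.2 - e.1).val
  mem_or : ∀ e ∈ E, s(e.1, e.2) ∈ T ∨ e.1 - e.2 = 1
  cover : ∀ a b, s(a, b) ∈ T → (a, b) ∈ E ∨ (b, a) ∈ E
  laminar : ∀ e ∈ E, ∀ f ∈ E, Between e.1 f.1 e.2 → (f.2 - f.1).val ≤ (e.2 - f.1).val

/-- The arc `e` is contained in the arc `f`. -/
def IsWithin {N : ℕ} (e f : ZMod N × ZMod N) : Prop :=
  (e.1 - f.1).val + (e.2 - e.1).val ≤ (f.2 - f.1).val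

open Classical in
/-- The vertices of the region directly below the arc `e`. -/
noncomputable def below {N : ℕ} [NeZero N] (E : Finset (ZMod N × ZMod N)) (e : ZMod N × ZMod N) :
    Finset (ZMod N) :=
  {c | (c - e.1).val ≤ (e.2 - e.1).val ∧ ∀ f ∈ E, Between f.1 c f.2 → IsWithin e f}

open Classical in
/-- The vertices that are not strictly below any arc. -/
noncomputable def center {N : ℕ} [NeZero N] (E : Finset (ZMod N × ZMod N)) : Finset (ZMod N) :=
  {c | ∀ f ∈ E, ¬ Between f.1 c f.2}

section Orientation

variable {N : ℕ} [NeZero N] {T : Finset (Sym2 (ZMod N))} {E : Finset (ZMod N × ZMod N)}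

theorem mem_below {e : ZMod N × ZMod N} {c : ZMod N} : c ∈ below E e ↔
    (c - e.1).val ≤ (e.2 - e.1).val ∧ ∀ f ∈ E, Between f.1 c f.2 → IsWithin e f := by
  simp [below]

theorem mem_center {c : ZMod N} : c ∈ center E ↔ ∀ f ∈ E, ¬ Between f.1 c f.2 := by
  simp [center]

theorem IsWithin.antisymm {e f : ZMod N × ZMod N} (h1 : IsWithin e f) (h2 : IsWithin f e) :
    e = f := by
  simp only [IsWithin] at *
  have h3 := dist_cases e.1 f.1 e.1
  have h4 := dist_cases e.1 f.1 e.2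
  have h5 := dist_cases e.1 f.1 f.2
  have h6 := dist_self e.1
  exact Prod.ext (eq_of_dist_eq e.1 (by omega)) (eq_of_dist_eq e.1 (by omega))

end Orientation

section Orientation

variable {N : ℕ} [NeZero N] {T : Finset (Sym2 (ZMod N))} {E : Finset (ZMod N × ZMod N)}

namespace IsOrientation

theorem isWithin_of_left (hE : IsOrientation T E) {e f : ZMod N × ZMod N} (he : e ∈ E)
    (hf : f ∈ E) (h : Between e.1 f.1 e.2) : IsWithin f e := by
  have h1 := hE.laminar e he f hf h
  simp only [IsWithin, Between] at *
  have h2 := dist_cases e.1 f.1 e.2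
  omega

theorem isWithin_of_right (hE : IsOrientation T E) {e f : ZMod N × ZMod N} (he : e ∈ E)
    (hf : f ∈ E) (h : Between e.1 f.2 e.2) : IsWithin f e := by
  by_cases h1 : Between e.1 f.1 e.2
  · exact hE.isWithin_of_left he hf h1
  · have h4 := hE.laminar f hf e he
    simp only [IsWithin, Between] at *
    have h2 := dist_cases e.1 f.1 e.2
    have h3 := dist_cases e.1 f.1 f.2
    have h5 := dist_cases e.1 f.1 e.1
    have h6 := dist_self e.1
    omega

theorem exists_next (hE : IsOrientation T E) (hN : 2 ≤ N) (Q : ZMod N × ZMod N → Prop)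
    {c : ZMod N} (hc : ∀ f ∈ E, Between f.1 c f.2 → Q f) :
    ∃ y, (∀ f ∈ E, Between f.1 y f.2 → Q f) ∧ (y = c + 1 ∨ ((c, y) ∈ E ∧ ¬ Q (c, y))) := by
  classical
  by_cases hc1 : ∀ f ∈ E, Between f.1 (c + 1) f.2 → Q f
  · exact ⟨c + 1, hc1, Or.inl rfl⟩
  push Not at hc1
  obtain ⟨f, hf, hfc, hQf⟩ := hc1
  have hone : (c + 1 - c).val = 1 := dist_eq_one hN (by ring)
  have hfst : f.1 = c := by
    by_contra hne
    have h1 : ¬ Between f.1 c f.2 := fun h => hQf (hc f hf h)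
    have h2 := dist_cases f.1 c (c + 1)
    have h3 := dist_ne f.1 (Ne.symm hne)
    rw [dist_self] at h3
    simp only [Between] at *
    omega
  obtain ⟨⟨a, y⟩, hg, hmax⟩ := (E.filter fun f => f.1 = c ∧ ¬ Q f).exists_max_image
    (fun f => (f.2 - f.1).val) ⟨f, Finset.mem_filter.2 ⟨hf, hfst, hQf⟩⟩
  obtain ⟨hgE, rfl, hgQ⟩ := Finset.mem_filter.1 hg
  simp only at *
  refine ⟨y, fun g hg hgy => ?_, Or.inr ⟨hgE, hgQ⟩⟩
  by_contra hQ
  have h1 : ¬ Between g.1 a g.2 := fun h => hQ (hc g hg h)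
  have h2 := hE.isWithin_of_right hg hgE hgy
  simp only [IsWithin, Between] at *
  have h3 : g.1 = a := by
    by_contra hne
    have h3 := dist_ne g.1 (Ne.symm hne)
    rw [dist_self] at h3
    have := hE.two_le _ hgE
    simp only at this
    omega
  have h4 := hmax g (Finset.mem_filter.2 ⟨hg, h3, hQ⟩)
  obtain ⟨g1, g2⟩ := g
  simp only at h3
  subst h3
  simp only at *
  omega

theorem left_mem_below (hE : IsOrientation T E) {e : ZMod N × ZMod N} (he : e ∈ E) :
    e.1 ∈ below E e :=
  mem_below.2 ⟨by rw [dist_self]; omega, fun _ hf h => hE.isWithin_of_left hf he h⟩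

theorem right_mem_below (hE : IsOrientation T E) {e : ZMod N × ZMod N} (he : e ∈ E) :
    e.2 ∈ below E e :=
  mem_below.2 ⟨le_rfl, fun _ hf h => hE.isWithin_of_right hf he h⟩

/-- The vertex of the region below `e` that follows `c`. -/
theorem exists_next_below (hE : IsOrientation T E) (hN : 2 ≤ N) {e : ZMod N × ZMod N}
    (he : e ∈ E) {c : ZMod N} (hc : c ∈ below E e) (hce : c ≠ e.2) :
    ∃ y, IsNext (below E e) c y ∧ (y = c + 1 ∨ ((c, y) ∈ E ∧ ¬ IsWithin e (c, y))) := by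
  obtain ⟨hc1, hc2⟩ := mem_below.1 hc
  obtain ⟨y, hy, h⟩ := hE.exists_next hN (fun f => IsWithin e f) hc2
  have hce' := dist_ne e.1 hce
  have key : y ∈ below E e ∧ c ≠ y ∧ ∀ x ∈ below E e, ¬ Between c x y := by
    rcases h with rfl | ⟨h1, h2⟩
    · have hone : (c + 1 - c).val = 1 := dist_eq_one hN (by ring)
      refine ⟨mem_below.2 ⟨?_, hy⟩, fun h => ?_, fun x _ hx => ?_⟩
      · have := dist_cases e.1 c (c + 1)
        have := dist_cases e.1 c e.2
        omega
      · rw [← h, dist_self] at hone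
        omega
      · simp only [Between] at hx
        omega
    · refine ⟨mem_below.2 ⟨?_, hy⟩, fun h => ?_, fun x hx hx' => ?_⟩
      · by_cases hcl : c = e.1
        · subst hcl
          simp only [IsWithin] at h2
          have := dist_self e.1
          omega
        · have h3 := dist_ne e.1 hcl
          rw [dist_self] at h3
          have h4 := hE.isWithin_of_left he h1 (by simp only [Between]; omega)
          simp only [IsWithin] at h4
          have := dist_cases e.1 c y
          omega
      · have := hE.two_le _ h1
        subst h
        simp only [dist_self] at this
        omega
      · exact h2 ((mem_below.1 hx).2 _ h1 hx')
  exact ⟨y, ⟨hc, key.1, key.2.1, key.2.2⟩, h⟩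

theorem isNext_below_right_left (hE : IsOrientation T E) {e : ZMod N × ZMod N}
    (he : e ∈ E) : IsNext (below E e) e.2 e.1 := by
  refine ⟨hE.right_mem_below he, hE.left_mem_below he, fun h => ?_, fun x hx hx' => ?_⟩
  · have := hE.two_le e he
    rw [h, dist_self] at this
    omega
  · have h1 := (mem_below.1 hx).1
    simp only [Between] at hx'
    have h2 := dist_cases e.1 e.2 x
    have h3 := dist_cases e.1 e.2 e.1
    have h4 := dist_self e.1
    omega

theorem three_le_card_below (hE : IsOrientation T E) (hN : 2 ≤ N) {e : ZMod N × ZMod N}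
    (he : e ∈ E) : 3 ≤ (below E e).card := by
  classical
  have hlen := hE.two_le e he
  have hne : e.1 ≠ e.2 := (hE.isNext_below_right_left he).2.2.1.symm
  obtain ⟨y, hy, h⟩ := hE.exists_next_below hN he (hE.left_mem_below he) hne
  have hy2 : y ≠ e.2 := by
    rintro rfl
    rcases h with h | ⟨-, h⟩
    · have := dist_eq_one hN (sub_eq_iff_eq_add'.2 h)
      omega
    · apply h
      simp [IsWithin]
  have hsub : ({e.1, y, e.2} : Finset (ZMod N)) ⊆ below E e := by
    intro x hx
    simp only [Finset.mem_insert, Finset.mem_singleton] at hx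
    rcases hx with rfl | rfl | rfl
    exacts [hE.left_mem_below he, hy.2.1, hE.right_mem_below he]
  refine le_trans (le_of_eq ?_) (Finset.card_le_card hsub)
  rw [Finset.card_insert_of_notMem, Finset.card_pair hy2]
  simp only [Finset.mem_insert, Finset.mem_singleton]
  exact fun h => h.elim hy.2.2.1 hne

omit [NeZero N] in
theorem isSide_or_mem (hE : IsOrientation T E) {e : ZMod N × ZMod N} (he : e ∈ E) :
    IsSide e.1 e.2 ∨ s(e.1, e.2) ∈ T :=
  (hE.mem_or e he).elim Or.inr fun h => Or.inl (Or.inr h)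

theorem isSubgon_below (hE : IsOrientation T E) (hT : IsDissection T) (hN : 2 ≤ N)
    {e : ZMod N × ZMod N} (he : e ∈ E) : IsSubgon T (below E e) := by
  refine ⟨hE.three_le_card_below hN he, fun a b hab => ?_, fun a b ha hb hab => ?_⟩
  · by_cases hae : a = e.2
    · subst hae
      rw [hab.right_unique (hE.isNext_below_right_left he)]
      exact (hE.isSide_or_mem he).imp Or.symm fun h => by rwa [Sym2.eq_swap]
    · obtain ⟨y, hy, h⟩ := hE.exists_next_below hN he hab.1 hae
      obtain rfl := hab.right_unique hy
      rcases h with rfl | ⟨h, -⟩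
      · exact Or.inl (Or.inl (by ring))
      · exact hE.isSide_or_mem h
  · wlog h : (a, b) ∈ E generalizing a b
    · exact (this b a hb ha (by rwa [Sym2.eq_swap]) ((hE.cover a b hab).resolve_left h)).symm
    by_cases hw : IsWithin e (a, b)
    · have h1 := (mem_below.1 ha).1
      have h2 := (mem_below.1 hb).1
      have h3 := hE.two_le e he
      have h4 := hE.two_le _ h
      simp only [IsWithin] at *
      have h5 := dist_cases e.1 a e.1
      have h6 := dist_cases e.1 a b
      have h7 := dist_self e.1
      have ha' : a = e.1 := eq_of_dist_eq e.1 (by omega)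
      have hb' : b = e.2 := eq_of_dist_eq e.1 (by omega)
      rw [ha', hb']
      exact Or.inr (hE.isNext_below_right_left he)
    · exact Or.inl ⟨ha, hb, (hT.diagonal a b hab).1, fun x hx hx' =>
        hw ((mem_below.1 hx).2 _ h hx')⟩

theorem isSubgon_center (hE : IsOrientation T E) (hT : IsDissection T) (hN : 2 ≤ N)
    (hcard : 3 ≤ (center E).card) : IsSubgon T (center E) := by
  refine ⟨hcard, fun a b hab => ?_, fun a b ha hb hab => ?_⟩
  · obtain ⟨y, hy, h⟩ := hE.exists_next hN (fun _ => False) (mem_center.1 hab.1)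
    have hyc : y ∈ center E := mem_center.2 hy
    have hyn : IsNext (center E) a y := by
      refine ⟨hab.1, hyc, ?_, fun x hx hx' => ?_⟩
      · rintro rfl
        rcases h with h | ⟨h, -⟩
        · have hone := dist_eq_one hN (a := a) (b := a + 1) (by ring)
          rw [← h, dist_self] at hone
          omega
        · have := hE.two_le _ h
          rw [dist_self] at this
          omega
      · rcases h with rfl | ⟨h, -⟩
        · have hone := dist_eq_one hN (a := a) (b := a + 1) (by ring)
          simp only [Between] at hx'
          omega
        · exact mem_center.1 hx _ h hx'
    obtain rfl := hab.right_unique hyn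
    rcases h with rfl | ⟨h, -⟩
    · exact Or.inl (Or.inl (by ring))
    · exact hE.isSide_or_mem h
  · wlog h : (a, b) ∈ E generalizing a b
    · exact (this b a hb ha (by rwa [Sym2.eq_swap]) ((hE.cover a b hab).resolve_left h)).symm
    exact Or.inl ⟨ha, hb, (hT.diagonal a b hab).1, fun x hx => mem_center.1 hx _ h⟩

end IsOrientation

/-- A subgon that meets the interior of the region cut off by a diagonal lies in that region. -/
theorem IsSubgon.dist_le_of_between {S : Finset (ZMod N)} (hS : IsSubgon T S)
    (hT : IsDissection T) {x y : ZMod N} (hxy : s(x, y) ∈ T ∨ x - y = 1) {c z : ZMod N}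
    (hc : c ∈ S) (hz : z ∈ S) (hcb : Between x c y) : (z - x).val ≤ (y - x).val := by
  have hcard := hS.three_le_card
  have hN : 2 ≤ N := by
    have := (Finset.card_le_univ S).trans_eq (ZMod.card N)
    omega
  by_contra! hlt
  rcases hxy with hxy | hxy
  swap
  · have h1 := dist_eq_one hN hxy
    have h2 := dist_cases x y x
    have h3 := dist_cases x y z
    rw [dist_self] at h2
    omega
  simp only [Between] at hcb
  have hx : x ∈ S := by
    by_contra hx
    obtain ⟨p, q, hpq, hpxq⟩ := exists_isNext_between (by omega) hx
    have h1 := dist_cases x p q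
    have h2 := dist_cases x p x
    have h3 := hpq.2.2.2 c hc
    have h4 := hpq.2.2.2 z hz
    have h5 := dist_cases x p c
    have h6 := dist_cases x p z
    have h7 := dist_self x
    have h8 := dist_cases x q y
    have h9 := dist_cases x q p
    simp only [Between] at *
    rcases hS.isNext_edge hpq with h | h
    · have := dist_eq_one hN h
      omega
    · refine hT.noncrossing p q x y h hxy ?_
      simp only [Between]
      omega
  have hy : y ∈ S := by
    by_contra hy
    obtain ⟨p, q, hpq, hpyq⟩ := exists_isNext_between (by omega) hy
    have h1 := dist_cases y p q
    have h2 := dist_cases y p y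
    have h3 := hpq.2.2.2 c hc
    have h4 := hpq.2.2.2 z hz
    have h5 := dist_cases y p c
    have h6 := dist_cases y p z
    have h7 := dist_self y
    have h8 := dist_cases y q x
    have h9 := dist_cases y q p
    have h10 := dist_cases y x c
    have h11 := dist_cases y x z
    have h12 := dist_cases y x y
    simp only [Between] at *
    rcases hS.isNext_edge hpq with h | h
    · have := dist_eq_one hN h
      omega
    · refine hT.noncrossing p q y x h (by rwa [Sym2.eq_swap]) ?_
      simp only [Between]
      omega
  rcases hS.interior x y hx hy hxy with h | h
  · exact h.2.2.2 c hc hcb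
  · refine h.2.2.2 z hz ?_
    have h1 := dist_cases x y z
    have h2 := dist_cases x y x
    have h3 := dist_self x
    simp only [Between]
    omega

end Orientation

section Orientation

variable {N : ℕ} [NeZero N] {T : Finset (Sym2 (ZMod N))} {E : Finset (ZMod N × ZMod N)}

namespace IsOrientation

/-- An oriented diagonal that bounds a subgon from below determines it. -/
theorem eq_below_of_isNext (hE : IsOrientation T E) (hT : IsDissection T) {S : Finset (ZMod N)}
    (hS : IsSubgon T S) {e : ZMod N × ZMod N} (he : e ∈ E) (hn : IsNext S e.2 e.1) :
    S = below E e := by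
  have hcard := hS.three_le_card
  have hN : 2 ≤ N := by
    have := (Finset.card_le_univ S).trans_eq (ZMod.card N)
    omega
  have hlen := hE.two_le e he
  have hlt := ZMod.val_lt (e.2 - e.1)
  have hself := dist_self e.1
  have hle (r) (hr : r ∈ S) : (r - e.1).val ≤ (e.2 - e.1).val := by
    by_cases hre : r = e.2
    · rw [hre]
    · have h1 := hn.dist_le hr hre
      have h2 := dist_cases e.1 e.2 r
      have h3 := dist_cases e.1 e.2 e.1
      omega
  ext c
  constructor
  · intro hc
    refine mem_below.2 ⟨hle c hc, fun f hf hfc => ?_⟩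
    have hd (z) (hz : z ∈ S) := hS.dist_le_of_between hT (hE.mem_or f hf) hc hz hfc
    have h1 := hd e.1 hn.2.1
    have h2 := hd e.2 hn.1
    have h3 := hle c hc
    have h4 := hE.isWithin_of_left (e := f) (f := e) hf he
    have h5 := hE.isWithin_of_right (e := f) (f := e) hf he
    simp only [IsWithin, Between] at *
    have h6 := dist_cases f.1 e.1 e.2
    have h7 := dist_cases f.1 e.1 c
    omega
  · intro hc
    by_contra hcS
    obtain ⟨hc1, hc2⟩ := mem_below.1 hc
    obtain ⟨p, q, hpq, hpcq⟩ := exists_isNext_between (by omega) hcS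
    have h1 := hle p hpq.1
    have h2 := hle q hpq.2.1
    have hne : ¬ (p = e.1 ∧ q = e.2) := by
      rintro ⟨rfl, rfl⟩
      obtain ⟨r, hr, -, -, h⟩ := hpq.exists_farther hcard
      have := hle r hr
      omega
    have hpq' : (p - e.1).val < (q - e.1).val := by
      by_contra! hle
      have h3 := hpq.2.2.2 _ hn.1
      have h4 := hpq.2.2.2 _ hn.2.1
      have h5 := dist_cases e.1 p q
      have h6 := dist_cases e.1 p e.1
      have h7 := dist_cases e.1 p e.2
      have h8 := dist_cases e.1 p c
      simp only [Between] at *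
      have h9 := dist_ne e.1 hpq.2.2.1
      omega
    have hT' : s(p, q) ∈ T := by
      refine (hS.isNext_edge hpq).resolve_left fun h => ?_
      have := dist_eq_one hN h
      simp only [Between] at hpcq
      omega
    have h5 := dist_cases e.1 p q
    have h5' := dist_cases e.1 q p
    have hne' : ¬ ((p - e.1).val = 0 ∧ (q - e.1).val = (e.2 - e.1).val) := fun h =>
      hne ⟨eq_of_dist_eq e.1 (by omega), eq_of_dist_eq e.1 h.2⟩
    rcases hE.cover p q hT' with h | h
    · have h6 := hc2 _ h hpcq
      have h7 := dist_cases e.1 p e.1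
      simp only [IsWithin] at h6
      omega
    · have h6 := hE.isWithin_of_left (e := e) (f := (q, p)) he h
      have h7 := hE.isWithin_of_right (e := e) (f := (q, p)) he h
      simp only [IsWithin, Between] at *
      omega

theorem eq_below_or_eq_center (hE : IsOrientation T E) (hT : IsDissection T)
    {S : Finset (ZMod N)} (hS : IsSubgon T S) : (∃ e ∈ E, S = below E e) ∨ S = center E := by
  by_cases hex : ∃ e ∈ E, IsNext S e.2 e.1
  · obtain ⟨e, he, hn⟩ := hex
    exact Or.inl ⟨e, he, hE.eq_below_of_isNext hT hS he hn⟩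
  push Not at hex
  right
  have hcard := hS.three_le_card
  have hN : 2 ≤ N := by
    have := (Finset.card_le_univ S).trans_eq (ZMod.card N)
    omega
  ext c
  rw [mem_center]
  constructor
  · intro hc f hf hfc
    have hd (z) (hz : z ∈ S) := hS.dist_le_of_between hT (hE.mem_or f hf) hc hz hfc
    obtain ⟨u, hu, hu'⟩ := S.exists_max_image (fun x => (x - f.1).val) ⟨c, hc⟩
    obtain ⟨v, hv, hv'⟩ := S.exists_min_image (fun x => (x - f.1).val) ⟨c, hc⟩
    have huv : v ≠ u := by
      rintro rfl
      have : S ⊆ {v} := fun x hx => Finset.mem_singleton.2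
        (eq_of_dist_eq f.1 (le_antisymm (hu' x hx) (hv' x hx)))
      have := Finset.card_le_card this
      rw [Finset.card_singleton] at this
      omega
    have h1 := dist_ne f.1 huv
    have h2 := hu' v hv
    have h3 := dist_cases f.1 u v
    have hn : IsNext S u v := by
      refine ⟨hu, hv, huv.symm, fun x hx hx' => ?_⟩
      have h4 := hu' x hx
      have h5 := hv' x hx
      have h6 := dist_cases f.1 u x
      simp only [Between] at hx'
      omega
    have hdu := hd u hu
    have hdv := hd v hv
    have hself := dist_self f.1
    have hnf : f ≠ (v, u) := by
      rintro rfl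
      exact hex _ hf hn
    have hnf' : ¬ ((v - f.1).val = 0 ∧ (u - f.1).val = (f.2 - f.1).val) := fun h =>
      hnf (Prod.ext (eq_of_dist_eq (b := v) f.1 (by omega)) (eq_of_dist_eq f.1 h.2.symm))
    have h4 := dist_cases f.1 u f.2
    rcases hS.isNext_edge hn with h | h
    · have := dist_eq_one hN h
      omega
    · have h5 := (hE.cover u v h).resolve_right fun h => hex _ h hn
      have h6 := hE.isWithin_of_left (e := f) (f := (u, v)) hf h5
      have h7 := hE.isWithin_of_right (e := f) (f := (u, v)) hf h5
      simp only [IsWithin, Between] at *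
      omega
  · intro hc
    by_contra hcS
    obtain ⟨p, q, hpq, hpcq⟩ := exists_isNext_between (by omega) hcS
    have hT' : s(p, q) ∈ T := by
      refine (hS.isNext_edge hpq).resolve_left fun h => ?_
      have := dist_eq_one hN h
      simp only [Between] at hpcq
      omega
    exact hc _ ((hE.cover p q hT').resolve_right fun h => hex _ h hpq) hpcq

/-- Apart from its ends, the vertices of the region below `e` are strictly below `e`. -/
theorem between_of_mem_below {e : ZMod N × ZMod N} {c : ZMod N} (hc : c ∈ below E e)
    (h1 : c ≠ e.1) (h2 : c ≠ e.2) : Between e.1 c e.2 := by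
  have h3 := (mem_below.1 hc).1
  have h4 := dist_ne e.1 h1
  have h5 := dist_ne e.1 h2
  rw [dist_self] at h4
  simp only [Between]
  omega

theorem exists_mem_below_ne (hE : IsOrientation T E) (hN : 2 ≤ N) {e : ZMod N × ZMod N}
    (he : e ∈ E) : ∃ c ∈ below E e, c ≠ e.1 ∧ c ≠ e.2 := by
  obtain ⟨r, hr, h1, h2, -⟩ :=
    (hE.isNext_below_right_left he).exists_farther (hE.three_le_card_below hN he)
  exact ⟨r, hr, h2, h1⟩

theorem isWithin_of_below_eq (hE : IsOrientation T E) (hN : 2 ≤ N) {e f : ZMod N × ZMod N}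
    (he : e ∈ E) (hf : f ∈ E) (h : below E e = below E f) : IsWithin f e := by
  obtain ⟨c, hc, h1, h2⟩ := hE.exists_mem_below_ne hN he
  have hb := between_of_mem_below hc h1 h2
  by_cases h3 : c = f.1
  · exact hE.isWithin_of_left he hf (h3 ▸ hb)
  by_cases h4 : c = f.2
  · exact hE.isWithin_of_right he hf (h4 ▸ hb)
  exact (mem_below.1 (h ▸ hc)).2 e he hb

theorem below_injOn (hE : IsOrientation T E) (hN : 2 ≤ N) : Set.InjOn (below E) E :=
  fun _ he _ hf h => (hE.isWithin_of_below_eq hN hf he h.symm).antisymm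
    (hE.isWithin_of_below_eq hN he hf h)

theorem below_ne_center (hE : IsOrientation T E) (hN : 2 ≤ N) {e : ZMod N × ZMod N}
    (he : e ∈ E) : below E e ≠ center E := by
  intro h
  obtain ⟨c, hc, h1, h2⟩ := hE.exists_mem_below_ne hN he
  exact mem_center.1 (h ▸ hc) e he (between_of_mem_below hc h1 h2)

theorem numSubgons_eq (hE : IsOrientation T E) (hT : IsDissection T) (hN : 2 ≤ N) {k : ℕ}
    (hk : 3 ≤ k) : numSubgons T k = (E.filter fun e => (below E e).card = k).card +
      if (center E).card = k then 1 else 0 := by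
  classical
  have hset : {S : Finset (ZMod N) | IsSubgon T S ∧ S.card = k} =
      (((E.filter fun e => (below E e).card = k).image (below E) ∪
        if (center E).card = k then {center E} else ∅ : Finset (Finset (ZMod N))) :
        Set (Finset (ZMod N))) := by
    ext S
    simp only [Set.mem_ofPred_eq, Finset.mem_coe, Finset.mem_union, Finset.mem_image,
      Finset.mem_filter]
    constructor
    · rintro ⟨hS, hSk⟩
      rcases hE.eq_below_or_eq_center hT hS with ⟨e, he, rfl⟩ | rfl
      · exact Or.inl ⟨e, ⟨he, hSk⟩, rfl⟩
      · right
        rw [if_pos hSk]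
        exact Finset.mem_singleton_self _
    · rintro (⟨e, ⟨he, h⟩, rfl⟩ | h)
      · exact ⟨hE.isSubgon_below hT hN he, h⟩
      · split_ifs at h with hc
        · rw [Finset.mem_singleton.1 h]
          exact ⟨hE.isSubgon_center hT hN (by omega), hc⟩
        · simp at h
  rw [numSubgons, hset, Set.ncard_coe_finset, Finset.card_union_of_disjoint,
    Finset.card_image_of_injOn]
  · split_ifs <;> rfl
  · exact (hE.below_injOn hN).mono fun e he => (Finset.mem_filter.1 he).1
  · rw [Finset.disjoint_left]
    intro S hS hS'
    obtain ⟨e, he, rfl⟩ := Finset.mem_image.1 hS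
    split_ifs at hS' with hc
    · exact hE.below_ne_center hN (Finset.mem_filter.1 he).1 (Finset.mem_singleton.1 hS')
    · simp at hS'

end IsOrientation
end Orientation

/-! ### Arc systems repeated around the circle -/

section Sector

variable {N : ℕ} [NeZero N]

/-- `dist_cases` relative to the vertex `0`. -/
theorem val_cases (a b : ZMod N) : a.val < N ∧ b.val < N ∧
    (a.val ≤ b.val ∧ (b - a).val + a.val = b.val ∨
      b.val < a.val ∧ (b - a).val + a.val = b.val + N) := by
  simpa only [sub_zero] using dist_cases 0 a b

/-- The copy of the arc `e` in the sector that starts at `j * g`. -/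
def liftArc (N g j : ℕ) (e : ℕ × ℕ) : ZMod N × ZMod N :=
  ((j * g + e.1 : ℕ), (j * g + e.1 : ℕ) + (e.2 - e.1 : ℕ))

/-- The directed arcs that are copies of arcs of `A` in the sectors of length `g`. -/
def arcsOf (N g : ℕ) [NeZero N] (A : Finset (ℕ × ℕ)) : Finset (ZMod N × ZMod N) :=
  {e | (e.1.val % g, e.1.val % g + (e.2 - e.1).val) ∈ A}

theorem mem_arcsOf {g : ℕ} {A : Finset (ℕ × ℕ)} {e : ZMod N × ZMod N} :
    e ∈ arcsOf N g A ↔ (e.1.val % g, e.1.val % g + (e.2 - e.1).val) ∈ A := by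
  simp [arcsOf]

theorem liftArc_mod {g : ℕ} (f : ZMod N × ZMod N) :
    liftArc N g (f.1.val / g) (f.1.val % g, f.1.val % g + (f.2 - f.1).val) = f := by
  have h : f.1.val / g * g + f.1.val % g = f.1.val := Nat.div_add_mod' _ _
  simp only [liftArc, h, Nat.add_sub_cancel_left, ZMod.natCast_zmod_val]
  exact Prod.ext rfl (by ring)

section

variable {d g m j : ℕ} {A : Finset (ℕ × ℕ)} {e : ℕ × ℕ}

omit [NeZero N] in
theorem mul_add_lt {x : ℕ} (hNg : N = d * g) (hj : j < d) (hx : x < g) : j * g + x < N := by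
  have : (j + 1) * g ≤ d * g := Nat.mul_le_mul_right _ hj
  rw [Nat.succ_mul] at this
  omega

omit [NeZero N] in
theorem natCast_mod {x : ℕ} (hNg : N = d * g) (hj : j < d) (hx : x < g) :
    ((j * g + x : ℕ) : ZMod N).val = j * g + x ∧ ((j * g + x : ℕ) : ZMod N).val % g = x ∧
      ((j * g + x : ℕ) : ZMod N).val / g = j := by
  have h1 := ZMod.val_natCast_of_lt (mul_add_lt (N := N) hNg hj hx)
  rw [h1]
  refine ⟨rfl, ?_, ?_⟩
  · rw [Nat.mul_add_mod', Nat.mod_eq_of_lt hx]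
  · rw [mul_comm, Nat.mul_add_div (by omega), Nat.div_eq_of_lt hx, add_zero]

theorem val_div_lt (hNg : N = d * g) (z : ZMod N) : z.val / g < d :=
  Nat.div_lt_of_lt_mul (by rw [mul_comm, ← hNg]; exact ZMod.val_lt z)

omit [NeZero N] in
theorem dist_liftArc (hmN : m < N) (he : e.2 ≤ m) :
    ((liftArc N g j e).2 - (liftArc N g j e).1).val = e.2 - e.1 := by
  rw [liftArc, add_sub_cancel_left, ZMod.val_natCast_of_lt (by omega)]

theorem liftArc_mem (hNg : N = d * g) (hmg : m ≤ g) (hmN : m < N)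
    (hA : IsArcSystem 0 m A) (hj : j < d) (he : e ∈ A) : liftArc N g j e ∈ arcsOf N g A := by
  have hb := hA.bounds e he
  rw [mem_arcsOf, dist_liftArc hmN hb.2.2, liftArc,
    (natCast_mod hNg hj (show e.1 < g by omega)).2.1, Nat.add_sub_cancel' (by omega)]
  exact he

/-- A vertex inside the sector after `a` at distance `t`. -/
theorem val_of_dist (hNg : N = d * g) {a z : ZMod N} (h : a.val % g + (z - a).val < g) :
    z.val % g = a.val % g + (z - a).val ∧ z.val / g = a.val / g := by
  have h1 := natCast_mod hNg (val_div_lt hNg a) h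
  rw [← add_assoc, Nat.div_add_mod', Nat.cast_add, ZMod.natCast_zmod_val, ZMod.natCast_zmod_val,
    add_sub_cancel] at h1
  exact h1.2

theorem mod_of_between (hNg : N = d * g) (hmg : m ≤ g) (hA : IsArcSystem 0 m A)
    {f : ZMod N × ZMod N} (hf : f ∈ arcsOf N g A) {z : ZMod N} (hz : Between f.1 z f.2) :
    z.val % g = f.1.val % g + (z - f.1).val ∧ z.val / g = f.1.val / g := by
  have hb := hA.bounds _ (mem_arcsOf.1 hf)
  simp only [Between] at *
  exact val_of_dist hNg (by omega)

theorem dist_liftArc_left (hNg : N = d * g) (hj : j < d) (he : e.1 < g) {z : ZMod N}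
    (hz : z.val / g = j) : (e.1 ≤ z.val % g ∧ (z - (liftArc N g j e).1).val = z.val % g - e.1) ∨
      (z.val % g < e.1 ∧ (z - (liftArc N g j e).1).val = z.val % g + N - e.1) := by
  have h1 := (natCast_mod (N := N) hNg hj he).1
  have h2 := val_cases (liftArc N g j e).1 z
  have h3 := Nat.div_add_mod' z.val g
  rw [hz] at h3
  have h4 : (liftArc N g j e).1.val = j * g + e.1 := h1
  omega

theorem forall_between_iff (hNg : N = d * g) (hmg : m ≤ g) (hmN : m < N)
    (hA : IsArcSystem 0 m A) (Q : ZMod N × ZMod N → Prop) (z : ZMod N) :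
    (∀ f ∈ arcsOf N g A, Between f.1 z f.2 → Q f) ↔
      ∀ f ∈ A, f.1 < z.val % g ∧ z.val % g < f.2 → Q (liftArc N g (z.val / g) f) := by
  constructor
  · intro h f hf hz
    have hb := hA.bounds f hf
    refine h _ (liftArc_mem hNg hmg hmN hA (val_div_lt hNg z) hf) ?_
    have h1 := dist_liftArc_left hNg (val_div_lt hNg z) (e := f) (by omega) rfl
    rw [Between, dist_liftArc hmN hb.2.2]
    omega
  · intro h f hf hz
    obtain ⟨h1, h2⟩ := mod_of_between hNg hmg hA hf hz
    have h3 := h _ (mem_arcsOf.1 hf) (by simp only [Between] at *; omega)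
    rwa [h2, liftArc_mod] at h3

theorem mem_center_arcsOf (hNg : N = d * g) (hmg : m ≤ g) (hmN : m < N)
    (hA : IsArcSystem 0 m A) {z : ZMod N} : z ∈ center (arcsOf N g A) ↔
      ∀ f ∈ A, ¬ (f.1 < z.val % g ∧ z.val % g < f.2) := by
  rw [mem_center]
  exact forall_between_iff hNg hmg hmN hA (fun _ => False) z

theorem card_center_arcsOf (hNg : N = d * g) (hmg : m ≤ g) (hmN : m < N)
    (hA : IsArcSystem 0 m A) : (center (arcsOf N g A)).card =
      d * ((Finset.range g).filter fun x => ∀ f ∈ A, ¬ (f.1 < x ∧ x < f.2)).card := by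
  have hg : 0 < g := Nat.pos_of_ne_zero fun h => NeZero.ne N (by rw [hNg, h, mul_zero])
  conv_rhs => rw [← Finset.card_range d, ← Finset.card_product]
  refine Finset.card_nbij' (fun z => (z.val / g, z.val % g)) (fun x => ((x.1 * g + x.2 : ℕ) : ZMod N))
    ?_ ?_ ?_ ?_
  · intro z hz
    rw [Finset.mem_coe, mem_center_arcsOf hNg hmg hmN hA] at hz
    simp only [Finset.coe_product, Set.mem_prod, Finset.mem_coe, Finset.mem_range,
      Finset.mem_filter]
    exact ⟨val_div_lt hNg z, Nat.mod_lt _ hg, hz⟩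
  · rintro ⟨i, x⟩ hx
    simp only [Finset.coe_product, Set.mem_prod, Finset.mem_coe, Finset.mem_range,
      Finset.mem_filter] at hx
    rw [Finset.mem_coe, mem_center_arcsOf hNg hmg hmN hA, (natCast_mod hNg hx.1 hx.2.1).2.1]
    exact hx.2.2
  · intro z _
    simp only [Nat.div_add_mod', ZMod.natCast_zmod_val]
  · rintro ⟨i, x⟩ hx
    simp only [Finset.coe_product, Set.mem_prod, Finset.mem_coe, Finset.mem_range,
      Finset.mem_filter] at hx
    have := natCast_mod (N := N) hNg hx.1 hx.2.1
    exact Prod.ext this.2.2 this.2.1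

theorem isWithin_liftArc_iff (hNg : N = d * g) (hmg : m ≤ g) (hmN : m < N) (hj : j < d)
    {e f : ℕ × ℕ} (he : e.1 + 2 ≤ e.2 ∧ e.2 ≤ m) (hf : f.1 + 2 ≤ f.2 ∧ f.2 ≤ m) :
    IsWithin (liftArc N g j e) (liftArc N g j f) ↔ f.1 ≤ e.1 ∧ e.2 ≤ f.2 := by
  have h1 : (liftArc N g j e).1.val % g = e.1 ∧ (liftArc N g j e).1.val / g = j :=
    (natCast_mod (N := N) hNg hj (show e.1 < g by omega)).2
  have h2 := dist_liftArc_left hNg hj (show f.1 < g by omega) h1.2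
  rw [h1.1] at h2
  rw [IsWithin, dist_liftArc hmN he.2, dist_liftArc hmN hf.2]
  omega

theorem mem_below_liftArc_iff {T : Finset (Sym2 (ZMod N))} (hNg : N = d * g) (hmg : m ≤ g)
    (hmN : m < N) (hA : IsArcSystem 0 m A) (hE : IsOrientation T (arcsOf N g A)) (hj : j < d)
    (he : e ∈ A) {x : ℕ} (hx : e.1 ≤ x ∧ x ≤ e.2) :
    (liftArc N g j e).1 + (x - e.1 : ℕ) ∈ below (arcsOf N g A) (liftArc N g j e) ↔
      x ∈ under A e := by
  have hb := hA.bounds e he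
  have hmem := liftArc_mem hNg hmg hmN hA hj he
  rcases eq_or_lt_of_le hx.2 with rfl | hlt
  · refine iff_of_true (hE.right_mem_below hmem) (mem_under.2 ⟨hx, fun f hf h => ?_⟩)
    have := hA.noncrossing f hf e he
    have := hA.bounds f hf
    have := hA.noncrossing e he f hf
    omega
  have h1 : (liftArc N g j e).1 + (x - e.1 : ℕ) = ((j * g + x : ℕ) : ZMod N) := by
    rw [liftArc, ← Nat.cast_add, add_assoc, Nat.add_sub_cancel' hx.1]
  have h2 := natCast_mod (N := N) hNg hj (show x < g by omega)
  have h3 := dist_liftArc_left hNg hj (e := e) (by omega) h2.2.2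
  rw [h1, mem_below, forall_between_iff hNg hmg hmN hA, h2.2.1, h2.2.2, mem_under,
    dist_liftArc hmN hb.2.2]
  refine and_congr (by omega) (forall₂_congr fun f hf => ?_)
  rw [isWithin_liftArc_iff hNg hmg hmN hj hb.2 (hA.bounds f hf).2]

theorem card_below_liftArc {T : Finset (Sym2 (ZMod N))} (hNg : N = d * g) (hmg : m ≤ g)
    (hmN : m < N) (hA : IsArcSystem 0 m A) (hE : IsOrientation T (arcsOf N g A)) (hj : j < d)
    (he : e ∈ A) : (below (arcsOf N g A) (liftArc N g j e)).card = (under A e).card := by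
  have hb := hA.bounds e he
  symm
  refine Finset.card_bij (fun x _ => (liftArc N g j e).1 + (x - e.1 : ℕ)) ?_ ?_ ?_
  · intro x hx
    exact (mem_below_liftArc_iff hNg hmg hmN hA hE hj he (mem_under.1 hx).1).2 hx
  · intro x hx y hy hxy
    have h1 := (mem_under.1 hx).1
    have h2 := (mem_under.1 hy).1
    have h3 := congrArg ZMod.val (add_left_cancel hxy)
    rw [ZMod.val_natCast_of_lt (by omega), ZMod.val_natCast_of_lt (by omega)] at h3
    omega
  · intro z hz
    have h1 := (mem_below.1 hz).1
    rw [dist_liftArc hmN hb.2.2] at h1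
    have h2 : (liftArc N g j e).1 +
        ((e.1 + (z - (liftArc N g j e).1).val - e.1 : ℕ) : ZMod N) = z := by
      rw [Nat.add_sub_cancel_left, ZMod.natCast_zmod_val, add_sub_cancel]
    refine ⟨e.1 + (z - (liftArc N g j e).1).val, ?_, h2⟩
    rw [← mem_below_liftArc_iff hNg hmg hmN hA hE hj he ⟨by omega, by omega⟩, h2]
    exact hz

theorem card_filter_below_arcsOf {T : Finset (Sym2 (ZMod N))} (hNg : N = d * g) (hmg : m ≤ g)
    (hmN : m < N) (hA : IsArcSystem 0 m A) (hE : IsOrientation T (arcsOf N g A)) (k : ℕ) :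
    ((arcsOf N g A).filter fun e => (below (arcsOf N g A) e).card = k).card =
      d * typeCount A k := by
  rw [typeCount]
  conv_rhs => rw [← Finset.card_range d, ← Finset.card_product]
  symm
  refine Finset.card_bij (fun x _ => liftArc N g x.1 x.2) ?_ ?_ ?_
  · rintro ⟨i, e⟩ hx
    simp only [Finset.mem_product, Finset.mem_range, Finset.mem_filter] at hx
    refine Finset.mem_filter.2 ⟨liftArc_mem hNg hmg hmN hA hx.1 hx.2.1, ?_⟩
    rw [card_below_liftArc hNg hmg hmN hA hE hx.1 hx.2.1, hx.2.2]
  · rintro ⟨i, e⟩ hx ⟨i', e'⟩ hx' heq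
    simp only [Finset.mem_product, Finset.mem_range, Finset.mem_filter] at hx hx'
    simp only at heq
    have hb := hA.bounds e hx.2.1
    have hb' := hA.bounds e' hx'.2.1
    have h1 := dist_liftArc (g := g) (j := i) hmN hb.2.2
    have h2 := dist_liftArc (g := g) (j := i') hmN hb'.2.2
    have h3 := natCast_mod (N := N) hNg hx.1 (show e.1 < g by omega)
    have h4 := natCast_mod (N := N) hNg hx'.1 (show e'.1 < g by omega)
    have h5 : ((i * g + e.1 : ℕ) : ZMod N) = ((i' * g + e'.1 : ℕ) : ZMod N) :=
      congrArg Prod.fst heq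
    rw [heq, h2] at h1
    rw [h5, h4.2.1, h4.2.2] at h3
    obtain ⟨-, h6, h7⟩ := h3
    exact Prod.ext h7.symm (Prod.ext h6.symm (by simp only; omega))
  · intro f hf
    obtain ⟨h1, h2⟩ := Finset.mem_filter.1 hf
    have h3 := mem_arcsOf.1 h1
    have h4 := card_below_liftArc hNg hmg hmN hA hE (val_div_lt hNg f.1) h3
    rw [liftArc_mod, h2] at h4
    refine ⟨(f.1.val / g, _), ?_, liftArc_mod f⟩
    simp only [Finset.mem_product, Finset.mem_range, Finset.mem_filter]
    exact ⟨val_div_lt hNg _, h3, h4.symm⟩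

theorem arcsOf_laminar (hNg : N = d * g) (hmg : m ≤ g) (hA : IsArcSystem 0 m A)
    {e f : ZMod N × ZMod N} (he : e ∈ arcsOf N g A) (hf : f ∈ arcsOf N g A)
    (h : Between e.1 f.1 e.2) : (f.2 - f.1).val ≤ (e.2 - f.1).val := by
  have h1 := mod_of_between hNg hmg hA he h
  have h2 := hA.noncrossing _ (mem_arcsOf.1 he) _ (mem_arcsOf.1 hf)
  have h3 := dist_cases e.1 f.1 e.2
  simp only [Between] at *
  omega

theorem numSubgons_eq_of_arcsOf {T : Finset (Sym2 (ZMod N))} (hNg : N = d * g) (hmg : m ≤ g)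
    (hmN : m < N) (hN : 2 ≤ N) (hA : IsArcSystem 0 m A) (hT : IsDissection T)
    (hmem : ∀ e ∈ arcsOf N g A, s(e.1, e.2) ∈ T ∨ e.1 - e.2 = 1)
    (hcov : ∀ a b, s(a, b) ∈ T → (a, b) ∈ arcsOf N g A ∨ (b, a) ∈ arcsOf N g A)
    {k : ℕ} (hk : 3 ≤ k) : numSubgons T k = d * typeCount A k +
      if d * ((Finset.range g).filter fun x => ∀ f ∈ A, ¬ (f.1 < x ∧ x < f.2)).card = k
      then 1 else 0 := by
  have hE : IsOrientation T (arcsOf N g A) := by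
    refine ⟨fun e he => ?_, hmem, hcov, fun e he f hf h => arcsOf_laminar hNg hmg hA he hf h⟩
    have := hA.bounds _ (mem_arcsOf.1 he)
    simp only at this
    omega
  rw [hE.numSubgons_eq hT hN hk, card_filter_below_arcsOf hNg hmg hmN hA hE,
    card_center_arcsOf hNg hmg hmN hA]

end
end Sector

section FromArcs

variable {N : ℕ} [NeZero N] {d g m : ℕ} {A : Finset (ℕ × ℕ)}

/-- The set of diagonals given by the arcs of `A` repeated around the circle. -/
def fromArcs (N g : ℕ) [NeZero N] (A : Finset (ℕ × ℕ)) : Finset (Sym2 (ZMod N)) :=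
  ((arcsOf N g A).filter fun e => (e.2 - e.1).val + 1 < N).image fun e => s(e.1, e.2)

theorem mem_fromArcs {a b : ZMod N} : s(a, b) ∈ fromArcs N g A ↔
    ((a, b) ∈ arcsOf N g A ∧ (b - a).val + 1 < N) ∨
      ((b, a) ∈ arcsOf N g A ∧ (a - b).val + 1 < N) := by
  simp only [fromArcs, Finset.mem_image, Finset.mem_filter]
  constructor
  · rintro ⟨⟨x, y⟩, h, hxy⟩
    rcases Sym2.eq_iff.1 hxy with ⟨rfl, rfl⟩ | ⟨rfl, rfl⟩
    · exact Or.inl h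
    · exact Or.inr h
  · rintro (h | h)
    · exact ⟨(a, b), h, rfl⟩
    · exact ⟨(b, a), h, Sym2.eq_swap⟩

theorem isDissection_fromArcs (hN : 2 ≤ N) (hNg : N = d * g) (hmg : m ≤ g)
    (hA : IsArcSystem 0 m A) : IsDissection (fromArcs N g A) := by
  constructor
  · intro a b hab
    wlog h : (a, b) ∈ arcsOf N g A ∧ (b - a).val + 1 < N generalizing a b
    · have := this b a (by rwa [Sym2.eq_swap]) ((mem_fromArcs.1 hab).resolve_left h)
      exact ⟨this.1.symm, fun hs => this.2 hs.symm⟩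
    have h1 := hA.bounds _ (mem_arcsOf.1 h.1)
    simp only at h1
    refine ⟨?_, ?_⟩
    · rintro rfl
      have := dist_self a
      omega
    · have h2 := dist_cases a b a
      rw [dist_self] at h2
      rintro (h3 | h3)
      · have := dist_eq_one hN h3
        omega
      · have := dist_eq_one hN h3
        omega
  · intro a b c e hab hce
    wlog h : (a, b) ∈ arcsOf N g A ∧ (b - a).val + 1 < N generalizing a b c e
    · have := this b a e c (by rwa [Sym2.eq_swap]) (by rwa [Sym2.eq_swap])
        ((mem_fromArcs.1 hab).resolve_left h)
      exact fun h => this h.symm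
    rintro ⟨h1, h2⟩
    have h3 := dist_cases a b c
    have h4 := dist_cases a b e
    have h5 := dist_cases a c e
    have h6 := dist_cases a c b
    have h7 := dist_cases a e a
    have h8 := dist_cases a e c
    have h9 := dist_cases a b a
    have h10 := dist_self a
    rcases mem_fromArcs.1 hce with ⟨h', -⟩ | ⟨h', -⟩
    · have := arcsOf_laminar hNg hmg hA h.1 h' h1
      simp only [Between] at *
      omega
    · have := arcsOf_laminar hNg hmg hA h' h.1
      simp only [Between] at *
      omega

end FromArcs

/-! ### Counting all dissections of given type -/

section Rooted

variable {n : ℕ}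

/-- The diagonals of the `(n + 2)`-gon as arcs on `[0, n + 1]`, together with the arc that spans
the whole interval. -/
def rootedArcs {n : ℕ} (T : Finset (Sym2 (ZMod (n + 2)))) : Finset (ℕ × ℕ) :=
  {e ∈ Finset.range (n + 2) ×ˢ Finset.range (n + 2) |
    e.1 + 2 ≤ e.2 ∧ (s((e.1 : ZMod (n + 2)), (e.2 : ZMod (n + 2))) ∈ T ∨ e = (0, n + 1))}

theorem mem_rootedArcs {T : Finset (Sym2 (ZMod (n + 2)))} {x y : ℕ} :
    (x, y) ∈ rootedArcs T ↔ (x + 2 ≤ y ∧ y ≤ n + 1) ∧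
      (s((x : ZMod (n + 2)), (y : ZMod (n + 2))) ∈ T ∨ (x, y) = (0, n + 1)) := by
  simp only [rootedArcs, Finset.mem_filter, Finset.mem_product, Finset.mem_range]
  constructor
  · rintro ⟨h1, h2, h3⟩
    exact ⟨by omega, h3⟩
  · rintro ⟨h1, h3⟩
    exact ⟨by omega, by omega, h3⟩

theorem dist_natCast {N x y : ℕ} [NeZero N] (hxy : x ≤ y) (hy : y < N) :
    ((y : ZMod N) - (x : ZMod N)).val = y - x := by
  rw [← Nat.cast_sub hxy, ZMod.val_natCast_of_lt (by omega)]

theorem dist_natCast_swap {N x y : ℕ} [NeZero N] (hxy : x < y) (hy : y < N) :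
    ((x : ZMod N) - (y : ZMod N)).val = N - (y - x) := by
  have h1 := dist_natCast hxy.le hy
  have h2 := val_cases (x : ZMod N) (y : ZMod N)
  have h3 := val_cases (y : ZMod N) (x : ZMod N)
  omega

theorem isArcSystem_rootedArcs {T : Finset (Sym2 (ZMod (n + 2)))} (hT : IsDissection T) :
    IsArcSystem 0 (n + 1) (rootedArcs T) := by
  constructor
  · rintro ⟨x, y⟩ he
    have := mem_rootedArcs.1 he
    simp only
    omega
  · rintro ⟨x, y⟩ he ⟨z, w⟩ hf ⟨h1, h2, h3⟩
    obtain ⟨he1, he2⟩ := mem_rootedArcs.1 he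
    obtain ⟨hf1, hf2⟩ := mem_rootedArcs.1 hf
    simp only [Prod.mk.injEq] at *
    refine hT.noncrossing x y z w (he2.resolve_right (by omega)) (hf2.resolve_right (by omega)) ?_
    rw [Between, Between, dist_natCast (by omega) (by omega), dist_natCast (by omega) (by omega),
      dist_natCast (by omega) (by omega), dist_natCast_swap (by omega) (by omega)]
    omega

theorem mem_rootedArcs_of_lt {T : Finset (Sym2 (ZMod (n + 2)))} (hT : IsDissection T)
    {a b : ZMod (n + 2)} (hab : s(a, b) ∈ T) (h : a.val < b.val) :
    (a.val, b.val) ∈ rootedArcs T := by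
  refine mem_rootedArcs.2 ⟨⟨?_, Nat.le_of_lt_succ (ZMod.val_lt b)⟩, Or.inl ?_⟩
  · by_contra hlt
    refine (hT.diagonal a b hab).2 (Or.inl (sub_eq_one_of_dist (by omega) ?_))
    have := val_cases a b
    omega
  · rwa [ZMod.natCast_zmod_val, ZMod.natCast_zmod_val]

theorem mem_of_mem_rootedArcs {T : Finset (Sym2 (ZMod (n + 2)))} {a b : ZMod (n + 2)}
    (h : (a.val, b.val) ∈ rootedArcs T) : s(a, b) ∈ T ∨ a - b = 1 := by
  rcases (mem_rootedArcs.1 h).2 with h1 | h1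
  · left
    rwa [ZMod.natCast_zmod_val, ZMod.natCast_zmod_val] at h1
  · right
    simp only [Prod.mk.injEq] at h1
    refine sub_eq_one_of_dist (by omega) ?_
    have := val_cases b a
    omega

theorem outer_rootedArcs {T : Finset (Sym2 (ZMod (n + 2)))} (hn : 1 ≤ n)
    (hT : IsDissection T) : outer 0 (n + 1) (rootedArcs T) = {0, n + 1} := by
  ext x
  simp only [Finset.mem_insert, Finset.mem_singleton]
  constructor
  · intro hx
    obtain ⟨h1, h2⟩ := mem_outer.1 hx
    have := h2 (0, n + 1) (mem_rootedArcs.2 ⟨by omega, Or.inr rfl⟩)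
    simp only at this
    omega
  · rintro (rfl | rfl)
    · exact (isArcSystem_rootedArcs hT).left_mem_outer (Nat.zero_le _)
    · exact (isArcSystem_rootedArcs hT).right_mem_outer (Nat.zero_le _)

theorem numSubgons_eq_typeCount_rootedArcs {T : Finset (Sym2 (ZMod (n + 2)))} (hn : 1 ≤ n)
    (hT : IsDissection T) {k : ℕ} (hk : 3 ≤ k) :
    numSubgons T k = typeCount (rootedArcs T) k := by
  have hA := isArcSystem_rootedArcs hT
  have hout : (Finset.range (n + 2)).filter
      (fun x => ∀ f ∈ rootedArcs T, ¬ (f.1 < x ∧ x < f.2)) = {0, n + 1} := by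
    rw [← outer_rootedArcs hn hT]
    ext x
    rw [Finset.mem_filter, mem_outer, Finset.mem_range]
    exact and_congr_left fun _ => by omega
  rw [numSubgons_eq_of_arcsOf (d := 1) (g := n + 2) (m := n + 1) (by omega) (by omega) (by omega)
    (by omega) hA hT ?_ ?_ hk, hout, Finset.card_pair (by omega), if_neg (by omega), one_mul,
    add_zero]
  · rintro ⟨a, b⟩ he
    rw [mem_arcsOf] at he
    have hb := hA.bounds _ he
    have h1 := val_cases a b
    have ha := Nat.mod_eq_of_lt (ZMod.val_lt a)
    simp only [ha] at he hb
    rw [show a.val + (b - a).val = b.val by omega] at he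
    exact mem_of_mem_rootedArcs he
  · intro a b hab
    wlog h : a.val < b.val generalizing a b
    · have hne : a.val ≠ b.val := fun h' => (hT.diagonal a b hab).1 (ZMod.val_injective _ h')
      exact (this b a (by rwa [Sym2.eq_swap]) (by omega)).symm
    left
    have h1 := val_cases a b
    have ha := Nat.mod_eq_of_lt (ZMod.val_lt a)
    rw [mem_arcsOf]
    simp only [ha]
    rw [show a.val + (b - a).val = b.val by omega]
    exact mem_rootedArcs_of_lt hT hab h

theorem rootedArcs_injOn : Set.InjOn rootedArcs
    {T : Finset (Sym2 (ZMod (n + 2))) | IsDissection T} := by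
  have key (T T' : Finset (Sym2 (ZMod (n + 2)))) (hT : IsDissection T)
      (h : rootedArcs T = rootedArcs T') : T ⊆ T' := by
    intro p
    induction p with | _ a b
    intro hab
    wlog hlt : a.val < b.val generalizing a b
    · have hne : a.val ≠ b.val := fun h' => (hT.diagonal a b hab).1 (ZMod.val_injective _ h')
      rw [Sym2.eq_swap]
      exact this b a (by rwa [Sym2.eq_swap]) (by omega)
    have h1 := mem_rootedArcs_of_lt hT hab hlt
    rw [h] at h1
    exact (mem_of_mem_rootedArcs h1).resolve_right fun h2 =>
      (hT.diagonal a b hab).2 (Or.inr h2)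
  exact fun T hT T' hT' h => (key T T' hT h).antisymm (key T' T hT' h.symm)

theorem rootedArcs_fromArcs {A : Finset (ℕ × ℕ)} (hA : IsArcSystem 0 (n + 1) A)
    (hroot : (0, n + 1) ∈ A) : rootedArcs (fromArcs (n + 2) (n + 2) A) = A := by
  ext ⟨x, y⟩
  rw [mem_rootedArcs, mem_fromArcs, mem_arcsOf, mem_arcsOf]
  have hb := hA.bounds (x, y)
  simp only at hb
  constructor
  · rintro ⟨h1, (h2 | h2) | h2⟩
    · have h3 := h2.1
      simp only [ZMod.val_natCast_of_lt (show x < n + 2 by omega),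
        dist_natCast (show x ≤ y by omega) (show y < n + 2 by omega)] at h3
      rwa [Nat.mod_eq_of_lt (by omega), Nat.add_sub_cancel' (by omega)] at h3
    · exfalso
      have h3 := h2.1
      simp only [ZMod.val_natCast_of_lt (show y < n + 2 by omega),
        dist_natCast_swap (show x < y by omega) (show y < n + 2 by omega)] at h3
      rw [Nat.mod_eq_of_lt (by omega)] at h3
      have := hA.bounds _ h3
      simp only at this
      omega
    · rwa [h2]
  · intro h
    have h1 := hb h
    refine ⟨by omega, ?_⟩
    by_cases hr : (x, y) = (0, n + 1)
    · exact Or.inr hr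
    · left
      left
      simp only [ZMod.val_natCast_of_lt (show x < n + 2 by omega),
        dist_natCast (show x ≤ y by omega) (show y < n + 2 by omega)]
      rw [Nat.mod_eq_of_lt (by omega), Nat.add_sub_cancel' (by omega)]
      simp only [Prod.mk.injEq] at hr
      exact ⟨h, by omega⟩

open Classical in
/-- The set of dissections of type `μ`. -/
noncomputable def dissections (n : ℕ) (μ : Fin n → ℕ) : Finset (Finset (Sym2 (ZMod (n + 2)))) :=
  {T | IsDissection T ∧ ∀ i : Fin n, numSubgons T ((i : ℕ) + 1 + 2) = μ i}

theorem mem_dissections {μ : Fin n → ℕ} {T : Finset (Sym2 (ZMod (n + 2)))} :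
    T ∈ dissections n μ ↔
      IsDissection T ∧ ∀ i : Fin n, numSubgons T ((i : ℕ) + 1 + 2) = μ i := by
  simp [dissections]

theorem card_dissections_eq_card_arcSystems (hn : 1 ≤ n) (μ : Fin n → ℕ) :
    (dissections n μ).card = (arcSystems 0 (n + 1) 1 μ).card := by
  refine Finset.card_bij (fun T _ => rootedArcs T) ?_ ?_ ?_
  · intro T hT
    obtain ⟨h1, h2⟩ := mem_dissections.1 hT
    refine mem_arcSystems.2 ⟨isArcSystem_rootedArcs h1, ?_, fun i => ?_⟩
    · rw [outer_rootedArcs hn h1, Finset.card_pair (by omega)]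
    · rw [← numSubgons_eq_typeCount_rootedArcs hn h1 (by omega), ← h2 i]
  · intro T hT T' hT' h
    exact rootedArcs_injOn (mem_dissections.1 hT).1 (mem_dissections.1 hT').1 h
  · intro A hA
    obtain ⟨h1, h2, h3⟩ := mem_arcSystems.1 hA
    have hroot : (0, n + 1) ∈ A := by
      obtain ⟨y, hy, hy0, h⟩ := h1.exists_first (by omega)
      have hy' : y = n + 1 := by
        by_contra hne
        have hsub : ({0, y, n + 1} : Finset ℕ) ⊆ outer 0 (n + 1) A := by
          intro x hx
          simp only [Finset.mem_insert, Finset.mem_singleton] at hx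
          rcases hx with rfl | rfl | rfl
          exacts [h1.left_mem_outer (by omega), hy, h1.right_mem_outer (by omega)]
        have := Finset.card_le_card hsub
        rw [Finset.card_insert_of_notMem (by simp; omega), Finset.card_pair hne] at this
        omega
      subst hy'
      exact h.resolve_left (by omega)
    have hT : IsDissection (fromArcs (n + 2) (n + 2) A) :=
      isDissection_fromArcs (d := 1) (by omega) (by omega) (by omega) h1
    have hr := rootedArcs_fromArcs h1 hroot
    refine ⟨fromArcs (n + 2) (n + 2) A, mem_dissections.2 ⟨hT, fun i => ?_⟩, hr⟩
    rw [numSubgons_eq_typeCount_rootedArcs hn hT (by omega), hr]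
    exact h3 i

end Rooted

/-! ### Rotationally symmetric dissections -/

section Symmetric

variable {N : ℕ}

/-- The set of diagonals `T` is mapped to itself by the rotation by `t`. -/
def IsInvariant (T : Finset (Sym2 (ZMod N))) (t : ZMod N) : Prop :=
  ∀ a b, s(a, b) ∈ T → s(a + t, b + t) ∈ T

theorem IsInvariant.natCast_mul {T : Finset (Sym2 (ZMod N))} {t : ZMod N} (h : IsInvariant T t)
    (k : ℕ) : IsInvariant T (k * t) := by
  induction k with
  | zero => intro a b hab; simpa using hab
  | succ k ih =>
    intro a b hab
    have := h _ _ (ih a b hab)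
    rwa [add_assoc, add_assoc, show (k : ZMod N) * t + t = (k + 1 : ℕ) * t by push_cast; ring]
      at this

variable [NeZero N]

theorem IsInvariant.mul {T : Finset (Sym2 (ZMod N))} {t : ZMod N} (h : IsInvariant T t)
    (z : ZMod N) : IsInvariant T (z * t) := by
  have := h.natCast_mul z.val
  rwa [ZMod.natCast_zmod_val] at this

theorem isInvariant_gcd_iff {T : Finset (Sym2 (ZMod N))} {j : ℕ} :
    IsInvariant T (Nat.gcd N j : ℕ) ↔ IsInvariant T (-(j : ZMod N)) := by
  constructor
  · intro h
    obtain ⟨c, hc⟩ := Nat.gcd_dvd_right N j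
    have := h.mul (-(c : ZMod N))
    rwa [show -(c : ZMod N) * (Nat.gcd N j : ℕ) = -(j : ZMod N) by
      conv_rhs => rw [hc]
      push_cast
      ring] at this
  · intro h
    have h1 : ((Nat.gcd N j : ℕ) : ZMod N) = -((Nat.gcdB N j : ℤ) : ZMod N) * -(j : ZMod N) := by
      have := congrArg (Int.cast : ℤ → ZMod N) (Nat.gcd_eq_gcd_ab N j)
      push_cast at this
      rw [this, ZMod.natCast_self]
      ring
    rw [h1]
    exact h.mul _

/-- The vertex `v` is not strictly below a diagonal of length at most `m`. -/
def IsCentral (m : ℕ) (T : Finset (Sym2 (ZMod N))) (v : ZMod N) : Prop :=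
  ∀ a b, s(a, b) ∈ T → (b - a).val ≤ m → ¬ Between a v b

variable {d m : ℕ} {T : Finset (Sym2 (ZMod N))}

omit [NeZero N] in
theorem two_mul_le_of_eq (hNm : N = d * m) (hd : 2 ≤ d) : 2 * m ≤ N := by
  rw [hNm]
  exact Nat.mul_le_mul_right m hd

omit [NeZero N] in
theorem IsInvariant.dist_le_or (hT : IsDissection T) (hinv : IsInvariant T m) (hm : 0 < m)
    (hNm : 2 * m ≤ N) {a b : ZMod N} (hab : s(a, b) ∈ T) :
    (b - a).val ≤ m ∨ (a - b).val ≤ m := by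
  by_contra! h
  have hval : ((m : ℕ) : ZMod N).val = m := ZMod.val_natCast_of_lt (by omega)
  refine hT.noncrossing a b (a + m) (b + m) hab (hinv a b hab) ?_
  simp only [Between, add_sub_cancel_left, hval]
  omega

theorem exists_isCentral (hT : IsDissection T) (hm : 0 < m) (hNm : 2 * m ≤ N) :
    ∃ v, IsCentral m T v := by
  classical
  rcases ((Finset.univ : Finset (ZMod N × ZMod N)).filter fun e =>
    s(e.1, e.2) ∈ T ∧ (e.2 - e.1).val ≤ m).eq_empty_or_nonempty with h | h
  · refine ⟨0, fun a b hab hle => ?_⟩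
    have : (a, b) ∉ (∅ : Finset (ZMod N × ZMod N)) := Finset.notMem_empty _
    rw [← h] at this
    simp only [Finset.mem_filter, Finset.mem_univ, true_and] at this
    exact absurd ⟨hab, hle⟩ this
  · obtain ⟨⟨a, b⟩, he, hmax⟩ := Finset.exists_max_image _ (fun e => (e.2 - e.1).val) h
    simp only [Finset.mem_filter, Finset.mem_univ, true_and] at he hmax
    refine ⟨a, fun x y hxy hle hb => ?_⟩
    have h1 := hmax (x, y) ⟨hxy, hle⟩
    have h2 := hT.noncrossing x y a b hxy he.1
    simp only [Between] at *
    have h3 := dist_cases x a b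
    have h4 := dist_cases x y b
    have h5 := dist_cases x y x
    have h6 := dist_self x
    have h7 := dist_cases x b x
    omega

/-- The diagonals of length at most `m` between the vertices `0, …, m`, as arcs on `[0, m]`. -/
def sectorArcs (m : ℕ) (T : Finset (Sym2 (ZMod N))) : Finset (ℕ × ℕ) :=
  {e ∈ Finset.range (m + 1) ×ˢ Finset.range (m + 1) |
    e.1 + 2 ≤ e.2 ∧ s((e.1 : ZMod N), (e.2 : ZMod N)) ∈ T}

omit [NeZero N] in
theorem mem_sectorArcs {x y : ℕ} :
    (x, y) ∈ sectorArcs m T ↔ (x + 2 ≤ y ∧ y ≤ m) ∧ s((x : ZMod N), (y : ZMod N)) ∈ T := by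
  simp only [sectorArcs, Finset.mem_filter, Finset.mem_product, Finset.mem_range]
  constructor
  · rintro ⟨h1, h2, h3⟩
    exact ⟨by omega, h3⟩
  · rintro ⟨h1, h3⟩
    exact ⟨by omega, by omega, h3⟩

theorem isArcSystem_sectorArcs (hT : IsDissection T) (hmN : m < N) :
    IsArcSystem 0 m (sectorArcs m T) := by
  constructor
  · rintro ⟨x, y⟩ he
    have := mem_sectorArcs.1 he
    simp only
    omega
  · rintro ⟨x, y⟩ he ⟨z, w⟩ hf ⟨h1, h2, h3⟩
    obtain ⟨he1, he2⟩ := mem_sectorArcs.1 he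
    obtain ⟨hf1, hf2⟩ := mem_sectorArcs.1 hf
    simp only at *
    refine hT.noncrossing x y z w he2 hf2 ?_
    rw [Between, Between, dist_natCast (by omega) (by omega), dist_natCast (by omega) (by omega),
      dist_natCast (by omega) (by omega), dist_natCast_swap (by omega) (by omega)]
    omega

theorem two_le_dist (hT : IsDissection T) (hN : 2 ≤ N) {a b : ZMod N} (hab : s(a, b) ∈ T) :
    2 ≤ (b - a).val := by
  by_contra! h
  obtain ⟨h1, h2⟩ := hT.diagonal a b hab
  have h3 := dist_ne a h1
  rw [dist_self] at h3
  exact h2 (Or.inl (sub_eq_one_of_dist hN (by omega)))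

theorem mem_arcsOf_sectorArcs (hT : IsDissection T) (hinv : IsInvariant T m)
    (hc : IsCentral m T 0) (hNm : N = d * m) (hd : 2 ≤ d) (hm : 0 < m) {a b : ZMod N} :
    (a, b) ∈ arcsOf N m (sectorArcs m T) ↔ s(a, b) ∈ T ∧ (b - a).val ≤ m := by
  have h2m := two_mul_le_of_eq hNm hd
  set r := a.val % m with hr
  have hrm : r < m := Nat.mod_lt _ hm
  have ha : (a.val / m : ℕ) * (m : ZMod N) + r = a := by
    rw [← Nat.cast_mul, ← Nat.cast_add, Nat.div_add_mod', ZMod.natCast_zmod_val]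
  have hb : (a.val / m : ℕ) * (m : ZMod N) + (r + (b - a).val : ℕ) = b := by
    rw [Nat.cast_add, ← add_assoc, ha, ZMod.natCast_zmod_val, add_sub_cancel]
  have hiff : s((r : ZMod N), ((r + (b - a).val : ℕ) : ZMod N)) ∈ T ↔ s(a, b) ∈ T := by
    constructor
    · intro h
      have := hinv.natCast_mul (a.val / m) _ _ h
      rwa [add_comm, ha, add_comm, hb] at this
    · intro h
      have := hinv.mul (-(a.val / m : ℕ)) _ _ h
      rwa [neg_mul, ← eq_add_neg_of_add_eq (by rw [add_comm]; exact ha),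
        ← eq_add_neg_of_add_eq (by rw [add_comm]; exact hb)] at this
  rw [mem_arcsOf, mem_sectorArcs, hiff]
  simp only [← hr]
  constructor
  · rintro ⟨h1, h2⟩
    exact ⟨h2, by omega⟩
  · rintro ⟨h1, h2⟩
    refine ⟨⟨by have := two_le_dist hT (by omega) h1; omega, ?_⟩, h1⟩
    by_contra! hlt
    have h3 := hinv.mul (-1) _ _ (hiff.2 h1)
    rw [neg_one_mul] at h3
    refine hc _ _ h3 ?_ ?_
    · rw [add_sub_add_right_eq_sub, Nat.cast_add, add_sub_cancel_left, ZMod.natCast_zmod_val]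
      exact h2
    · rw [Between, add_sub_add_right_eq_sub, Nat.cast_add, add_sub_cancel_left,
        ZMod.natCast_zmod_val, show (0 : ZMod N) - (r + -m) = (m : ZMod N) - r by ring,
        dist_natCast hrm.le (by omega)]
      omega

theorem cover_sectorArcs (hT : IsDissection T) (hinv : IsInvariant T m)
    (hc : IsCentral m T 0) (hNm : N = d * m) (hd : 2 ≤ d) (hm : 0 < m) {a b : ZMod N}
    (hab : s(a, b) ∈ T) :
    (a, b) ∈ arcsOf N m (sectorArcs m T) ∨ (b, a) ∈ arcsOf N m (sectorArcs m T) := by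
  have h2m := two_mul_le_of_eq hNm hd
  rw [mem_arcsOf_sectorArcs hT hinv hc hNm hd hm, mem_arcsOf_sectorArcs hT hinv hc hNm hd hm]
  exact (hinv.dist_le_or hT hm h2m hab).imp (fun h => ⟨hab, h⟩)
    fun h => ⟨by rwa [Sym2.eq_swap], h⟩

theorem card_range_filter_uncovered {A : Finset (ℕ × ℕ)} (hA : IsArcSystem 0 m A) :
    ((Finset.range m).filter fun x => ∀ f ∈ A, ¬ (f.1 < x ∧ x < f.2)).card + 1 =
      (outer 0 m A).card := by
  have : outer 0 m A =
      insert m ((Finset.range m).filter fun x => ∀ f ∈ A, ¬ (f.1 < x ∧ x < f.2)) := by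
    ext x
    simp only [mem_outer, Finset.mem_insert, Finset.mem_filter, Finset.mem_range]
    constructor
    · rintro ⟨h1, h2⟩
      by_cases hx : x = m
      · exact Or.inl hx
      · exact Or.inr ⟨by omega, h2⟩
    · rintro (rfl | ⟨h1, h2⟩)
      · exact mem_outer.1 (hA.right_mem_outer (Nat.zero_le _))
      · exact ⟨by omega, h2⟩
  rw [this, Finset.card_insert_of_notMem (by simp)]

theorem numSubgons_eq_of_isCentral (hT : IsDissection T) (hinv : IsInvariant T m)
    (hc : IsCentral m T 0) (hNm : N = d * m) (hd : 2 ≤ d) (hm : 0 < m) {s : ℕ}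
    (hs : (outer 0 m (sectorArcs m T)).card = s + 1) {k : ℕ} (hk : 3 ≤ k) :
    numSubgons T k = d * typeCount (sectorArcs m T) k + if d * s = k then 1 else 0 := by
  have h2m := two_mul_le_of_eq hNm hd
  have hA := isArcSystem_sectorArcs hT (show m < N by omega)
  have h1 := card_range_filter_uncovered hA
  rw [numSubgons_eq_of_arcsOf hNm le_rfl (by omega) (by omega) hA hT
    (fun e he => Or.inl ((mem_arcsOf_sectorArcs hT hinv hc hNm hd hm).1 he).1)
    (fun a b hab => cover_sectorArcs hT hinv hc hNm hd hm hab) hk,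
    show (Finset.card _) = s by omega]

open Classical in
theorem card_isCentral_of_zero (hT : IsDissection T) (hinv : IsInvariant T m)
    (hc : IsCentral m T 0) (hNm : N = d * m) (hd : 2 ≤ d) (hm : 0 < m) {s : ℕ}
    (hs : (outer 0 m (sectorArcs m T)).card = s + 1) :
    ((Finset.univ : Finset (ZMod N)).filter fun v => IsCentral m T v).card = d * s := by
  have h2m := two_mul_le_of_eq hNm hd
  have hA := isArcSystem_sectorArcs hT (show m < N by omega)
  have h1 := card_range_filter_uncovered hA
  have h2 := card_center_arcsOf (N := N) hNm le_rfl (by omega) hA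
  rw [show (Finset.card (Finset.filter _ (Finset.range m))) = s by omega] at h2
  rw [← h2]
  congr 1
  ext v
  rw [mem_center, Finset.mem_filter, and_iff_right (Finset.mem_univ v), IsCentral, Prod.forall]
  refine forall₂_congr fun a b => ?_
  rw [mem_arcsOf_sectorArcs hT hinv hc hNm hd hm, and_imp]

theorem sectorArcs_inj {T' : Finset (Sym2 (ZMod N))} (hT : IsDissection T)
    (hinv : IsInvariant T m) (hc : IsCentral m T 0) (hT' : IsDissection T')
    (hinv' : IsInvariant T' m) (hc' : IsCentral m T' 0) (hNm : N = d * m) (hd : 2 ≤ d)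
    (hm : 0 < m) (h : sectorArcs m T = sectorArcs m T') : T ⊆ T' := by
  intro p
  induction p with | _ a b
  intro hab
  rcases cover_sectorArcs hT hinv hc hNm hd hm hab with h1 | h1
  · rw [h] at h1
    exact ((mem_arcsOf_sectorArcs hT' hinv' hc' hNm hd hm).1 h1).1
  · rw [h] at h1
    rw [Sym2.eq_swap]
    exact ((mem_arcsOf_sectorArcs hT' hinv' hc' hNm hd hm).1 h1).1

/-! ### Dissections from arc systems on a sector -/

variable {A : Finset (ℕ × ℕ)}

theorem mem_fromArcs_and_dist_le (hA : IsArcSystem 0 m A) (hNm : N = d * m) (hd : 2 ≤ d)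
    (hm : 0 < m) {a b : ZMod N} :
    s(a, b) ∈ fromArcs N m A ∧ (b - a).val ≤ m ↔ (a, b) ∈ arcsOf N m A := by
  have h2m := two_mul_le_of_eq hNm hd
  constructor
  · rintro ⟨h1, h2⟩
    rcases mem_fromArcs.1 h1 with h | h
    · exact h.1
    · have h3 := mem_arcsOf.1 h.1
      have h4 := hA.bounds _ h3
      simp only at h3 h4
      have h5 := dist_cases b a b
      rw [dist_self] at h5
      have h6 : (a - b).val = m := by omega
      have h7 : b.val % m = 0 := by omega
      have h8 : a.val % m = 0 := by
        have h9 := val_cases b a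
        have h10 := Nat.div_add_mod' b.val m
        have h11 : m ∣ N := ⟨d, by rw [hNm, mul_comm]⟩
        have h12 : m ∣ b.val := Nat.dvd_of_mod_eq_zero h7
        have h13 : m ∣ a.val + N ∨ m ∣ a.val := by
          rcases h9.2.2 with ⟨-, h⟩ | ⟨-, h⟩
          · right
            rw [← h, h6]
            exact dvd_add dvd_rfl h12
          · left
            rw [← h, h6]
            exact dvd_add dvd_rfl h12
        exact Nat.mod_eq_zero_of_dvd (h13.elim (fun h => (Nat.dvd_add_left h11).1 h) id)
      rw [mem_arcsOf]
      simp only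
      rw [h8, show (b - a).val = (a - b).val by omega]
      rwa [h7] at h3
  · intro h
    have h1 := hA.bounds _ (mem_arcsOf.1 h)
    simp only at h1
    exact ⟨mem_fromArcs.2 (Or.inl ⟨h, by omega⟩), by omega⟩

theorem isInvariant_fromArcs (hNm : N = d * m) : IsInvariant (fromArcs N m A) m := by
  have key (a : ZMod N) : (a + m).val % m = a.val % m := by
    have hdvd : m ∣ N := ⟨d, by rw [hNm, mul_comm]⟩
    rw [ZMod.val_add, Nat.mod_mod_of_dvd _ hdvd, ZMod.val_natCast, Nat.add_mod,
      Nat.mod_mod_of_dvd _ hdvd, Nat.mod_self, add_zero, Nat.mod_mod]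
  intro a b hab
  rw [mem_fromArcs] at *
  simp only [mem_arcsOf, key, add_sub_add_right_eq_sub] at *
  exact hab

theorem isCentral_fromArcs (hA : IsArcSystem 0 m A) (hNm : N = d * m) (hd : 2 ≤ d)
    (hm : 0 < m) : IsCentral m (fromArcs N m A) 0 := by
  intro a b hab hle hb
  have h1 := (mod_of_between hNm le_rfl hA
    ((mem_fromArcs_and_dist_le hA hNm hd hm).1 ⟨hab, hle⟩) hb).1
  simp only [Between, ZMod.val_zero, Nat.zero_mod] at *
  omega

theorem sectorArcs_fromArcs (hA : IsArcSystem 0 m A) (hNm : N = d * m) (hd : 2 ≤ d)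
    (hm : 0 < m) : sectorArcs m (fromArcs N m A) = A := by
  have h2m := two_mul_le_of_eq hNm hd
  ext ⟨x, y⟩
  rw [mem_sectorArcs]
  have key (hxy : x + 2 ≤ y ∧ y ≤ m) :
      s((x : ZMod N), (y : ZMod N)) ∈ fromArcs N m A ↔ (x, y) ∈ A := by
    have hdist := dist_natCast (N := N) (show x ≤ y by omega) (by omega)
    have h1 := mem_fromArcs_and_dist_le hA hNm hd hm (a := (x : ZMod N)) (b := (y : ZMod N))
    rw [hdist, and_iff_left (by omega), mem_arcsOf] at h1
    simp only [hdist, ZMod.val_natCast_of_lt (show x < N by omega)] at h1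
    rwa [Nat.mod_eq_of_lt (by omega), Nat.add_sub_cancel' (by omega)] at h1
  constructor
  · rintro ⟨h1, h2⟩
    exact (key h1).1 h2
  · intro h
    have h1 := (hA.bounds _ h).2
    exact ⟨h1, (key h1).2 h⟩

end Symmetric

section Rotation

variable {N : ℕ}

theorem rotationGen_pow_apply (N j : ℕ) (x : ZMod N) :
    ((rotationGen N ^ j : RotationGroup N) : Equiv.Perm (ZMod N)) x = x - j := by
  induction j generalizing x with
  | zero => simp
  | succ j ih =>
    rw [pow_succ, Subgroup.coe_mul, Equiv.Perm.mul_apply, ih]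
    simp only [rotationGen, rotation, Equiv.subRight_apply]
    push_cast
    ring

theorem mem_mapDiagonals_pow {T : Finset (Sym2 (ZMod N))} {j : ℕ} {a b : ZMod N} :
    s(a, b) ∈ mapDiagonals (rotationGen N ^ j : RotationGroup N).1 T ↔ s(a + j, b + j) ∈ T := by
  have h := mk_mem_mapDiagonals (rotationGen N ^ j : RotationGroup N).1 T (a + j) (b + j)
  rwa [rotationGen_pow_apply, rotationGen_pow_apply, add_sub_cancel_right,
    add_sub_cancel_right] at h

theorem mapDiagonals_pow_eq_self_iff [NeZero N] {T : Finset (Sym2 (ZMod N))} {j : ℕ} :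
    mapDiagonals (rotationGen N ^ j : RotationGroup N).1 T = T ↔
      IsInvariant T (Nat.gcd N j : ℕ) := by
  rw [isInvariant_gcd_iff]
  constructor
  · intro h a b hab
    rw [← h, mem_mapDiagonals_pow]
    simpa using hab
  · intro h
    ext p
    induction p with | _ a b
    rw [mem_mapDiagonals_pow]
    constructor
    · intro hab
      simpa using h _ _ hab
    · intro hab
      have := h.mul (-1) _ _ hab
      simpa using this

theorem isCentral_mapDiagonals {T : Finset (Sym2 (ZMod N))} {m j : ℕ} {v : ZMod N} :
    IsCentral m (mapDiagonals (rotationGen N ^ j : RotationGroup N).1 T) v ↔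
      IsCentral m T (v + j) := by
  simp only [IsCentral, mem_mapDiagonals_pow, Between]
  constructor
  · intro h a b hab hle
    have := h (a - j) (b - j) (by simpa using hab) (by simpa using hle)
    rw [sub_sub_sub_cancel_right] at this
    rwa [show v - (a - j) = v + j - a by ring] at this
  · intro h a b hab hle
    have := h _ _ hab (by simpa using hle)
    simpa using this

theorem isInvariant_mapDiagonals {T : Finset (Sym2 (ZMod N))} {j : ℕ} {t : ZMod N}
    (h : IsInvariant T t) :
    IsInvariant (mapDiagonals (rotationGen N ^ j : RotationGroup N).1 T) t := by
  intro a b hab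
  rw [mem_mapDiagonals_pow] at *
  have := h _ _ hab
  rwa [add_right_comm, add_right_comm b]

end Rotation

/-! ### Counting symmetric dissections -/

section Count

variable {n d m : ℕ} {μ : Fin n → ℕ}

open Classical in
/-- The dissections of type `μ` that are symmetric under the rotation by `m`. -/
noncomputable def symDissections (n m : ℕ) (μ : Fin n → ℕ) :
    Finset (Finset (Sym2 (ZMod (n + 2)))) :=
  {T ∈ dissections n μ | IsInvariant T (m : ZMod (n + 2))}

theorem mem_symDissections {T : Finset (Sym2 (ZMod (n + 2)))} :
    T ∈ symDissections n m μ ↔ T ∈ dissections n μ ∧ IsInvariant T (m : ZMod (n + 2)) := by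
  simp [symDissections]

theorem mapDiagonals_mem_symDissections {T : Finset (Sym2 (ZMod (n + 2)))}
    (hT : T ∈ symDissections n m μ) (j : ℕ) :
    mapDiagonals (rotationGen (n + 2) ^ j : RotationGroup (n + 2)).1 T ∈ symDissections n m μ := by
  obtain ⟨h1, h2⟩ := mem_symDissections.1 hT
  obtain ⟨h3, h4⟩ := mem_dissections.1 h1
  exact mem_symDissections.2 ⟨mem_dissections.2 ⟨isDissection_rotation _ h3,
    fun i => (numSubgons_rotation _ T _).trans (h4 i)⟩, isInvariant_mapDiagonals h2⟩

/-- If `0` is a central vertex, then the central polygon has `d * s` vertices and the type is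
determined by the arcs in one sector. -/
theorem exists_type_eq {T : Finset (Sym2 (ZMod (n + 2)))} (hT : T ∈ symDissections n m μ)
    (hc : IsCentral m T 0) (hNm : n + 2 = d * m) (hd : 2 ≤ d) (hm : 0 < m) :
    ∃ s, 0 < s ∧ d * s ≤ n + 2 ∧ (outer 0 m (sectorArcs m T)).card = s + 1 ∧
      ∀ i : Fin n, μ i = d * typeCount (sectorArcs m T) ((i : ℕ) + 3) +
        if d * s = (i : ℕ) + 3 then 1 else 0 := by
  obtain ⟨h1, h2⟩ := mem_symDissections.1 hT
  obtain ⟨h3, h4⟩ := mem_dissections.1 h1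
  have h2m := two_mul_le_of_eq hNm hd
  have hA := isArcSystem_sectorArcs h3 (show m < n + 2 by omega)
  have hge : 2 ≤ (outer 0 m (sectorArcs m T)).card := by
    have hsub : ({0, m} : Finset ℕ) ⊆ outer 0 m (sectorArcs m T) := by
      intro x hx
      simp only [Finset.mem_insert, Finset.mem_singleton] at hx
      rcases hx with rfl | rfl
      exacts [hA.left_mem_outer (Nat.zero_le _), hA.right_mem_outer (Nat.zero_le _)]
    have := Finset.card_le_card hsub
    rwa [Finset.card_pair hm.ne] at this
  have hle : (outer 0 m (sectorArcs m T)).card ≤ m + 1 :=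
    (Finset.card_filter_le _ _).trans (by rw [Nat.card_Icc]; omega)
  obtain ⟨s, hs⟩ : ∃ s, (outer 0 m (sectorArcs m T)).card = s + 1 :=
    ⟨(outer 0 m (sectorArcs m T)).card - 1, by omega⟩
  refine ⟨s, by omega, ?_, hs, fun i => ?_⟩
  · rw [hNm]
    exact Nat.mul_le_mul_left d (by omega)
  · rw [← h4 i, ← numSubgons_eq_of_isCentral h3 h2 hc hNm hd hm hs (by omega)]

theorem eq_of_type_eq {s s' : ℕ} {ν ν' : Fin n → ℕ} (hd : 2 ≤ d) (hs : 0 < s) (hs' : 0 < s')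
    (hn : d * s ≤ n + 2) (hn' : d * s' ≤ n + 2)
    (h : ∀ i : Fin n, d * ν i + (if d * s = (i : ℕ) + 3 then 1 else 0) =
      d * ν' i + if d * s' = (i : ℕ) + 3 then 1 else 0) : s = s' ∧ ν = ν' := by
  have hss : s = s' := by
    by_contra hne
    wlog hlt : s < s' generalizing s s' ν ν'
    · exact this hs' hs hn' hn (fun i => (h i).symm) (Ne.symm hne) (by omega)
    have h1 : d * (s + 1) ≤ d * s' := Nat.mul_le_mul_left d hlt
    have h2 : d * 1 ≤ d * s := Nat.mul_le_mul_left d hs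
    rw [mul_add] at h1
    have h3 := h ⟨d * s' - 3, by omega⟩
    simp only at h3
    rw [if_neg (by omega), if_pos (by omega), add_zero] at h3
    have h4 := congrArg (· % d) h3
    simp only [Nat.mul_mod_right, Nat.mul_add_mod, Nat.mod_eq_of_lt (show 1 < d by omega)] at h4
    omega
  subst hss
  refine ⟨rfl, funext fun i => ?_⟩
  exact Nat.eq_of_mul_eq_mul_left (by omega) (Nat.add_right_cancel (h i))

open Classical in
theorem card_symDissections_isCentral (hNm : n + 2 = d * m) (hd : 2 ≤ d) (hm : 0 < m) {s : ℕ}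
    {ν : Fin n → ℕ} (hs : 0 < s) (hsn : d * s ≤ n + 2)
    (hμ : ∀ i : Fin n, μ i = d * ν i + if d * s = (i : ℕ) + 3 then 1 else 0) :
    ((symDissections n m μ).filter fun T => IsCentral m T 0).card =
      (arcSystems 0 m s ν).card := by
  have h2m := two_mul_le_of_eq hNm hd
  refine Finset.card_bij (fun T _ => sectorArcs m T) ?_ ?_ ?_
  · intro T hT
    obtain ⟨h1, h2⟩ := Finset.mem_filter.1 hT
    obtain ⟨h3, h4⟩ := mem_symDissections.1 h1
    obtain ⟨s', hs', hsn', hout, htype⟩ := exists_type_eq h1 h2 hNm hd hm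
    obtain ⟨rfl, hν⟩ := eq_of_type_eq (ν := ν) (ν' := fun i : Fin n => typeCount (sectorArcs m T)
      ((i : ℕ) + 3)) hd hs hs' hsn hsn' fun i => by rw [← hμ, htype]
    exact mem_arcSystems.2 ⟨isArcSystem_sectorArcs (mem_dissections.1 h3).1 (by omega), hout,
      fun i => (congrFun hν i).symm⟩
  · intro T hT T' hT' h
    obtain ⟨h1, h2⟩ := Finset.mem_filter.1 hT
    obtain ⟨h3, h4⟩ := mem_symDissections.1 h1
    obtain ⟨h1', h2'⟩ := Finset.mem_filter.1 hT'
    obtain ⟨h3', h4'⟩ := mem_symDissections.1 h1'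
    have h5 := (mem_dissections.1 h3).1
    have h5' := (mem_dissections.1 h3').1
    exact (sectorArcs_inj h5 h4 h2 h5' h4' h2' hNm hd hm h).antisymm
      (sectorArcs_inj h5' h4' h2' h5 h4 h2 hNm hd hm h.symm)
  · intro A hA
    obtain ⟨h1, h2, h3⟩ := mem_arcSystems.1 hA
    have hT : IsDissection (fromArcs (n + 2) m A) :=
      isDissection_fromArcs (by omega) hNm le_rfl h1
    have hinv := isInvariant_fromArcs (A := A) hNm
    have hc := isCentral_fromArcs h1 hNm hd hm
    have hsec := sectorArcs_fromArcs h1 hNm hd hm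
    refine ⟨fromArcs (n + 2) m A, Finset.mem_filter.2 ⟨mem_symDissections.2
      ⟨mem_dissections.2 ⟨hT, fun i => ?_⟩, hinv⟩, hc⟩, hsec⟩
    rw [numSubgons_eq_of_isCentral hT hinv hc hNm hd hm (by rw [hsec, h2]) (by omega), hsec, hμ,
      ← h3 i]

/-- A symmetric dissection can be rotated so that `0` becomes a central vertex. -/
theorem exists_rotate_isCentral {T : Finset (Sym2 (ZMod (n + 2)))}
    (hT : T ∈ symDissections n m μ) (hNm : n + 2 = d * m) (hd : 2 ≤ d) (hm : 0 < m) :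
    ∃ j : ℕ, IsCentral m (mapDiagonals (rotationGen (n + 2) ^ j : RotationGroup (n + 2)).1 T)
      0 := by
  obtain ⟨v, hv⟩ := exists_isCentral (mem_dissections.1 (mem_symDissections.1 hT).1).1 hm
    (two_mul_le_of_eq hNm hd)
  refine ⟨v.val, isCentral_mapDiagonals.2 ?_⟩
  rwa [ZMod.natCast_zmod_val, zero_add]

open Classical in
theorem card_isCentral {T : Finset (Sym2 (ZMod (n + 2)))}
    (hT : T ∈ symDissections n m μ) (hNm : n + 2 = d * m) (hd : 2 ≤ d) (hm : 0 < m) {s : ℕ}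
    {ν : Fin n → ℕ} (hs : 0 < s) (hsn : d * s ≤ n + 2)
    (hμ : ∀ i : Fin n, μ i = d * ν i + if d * s = (i : ℕ) + 3 then 1 else 0) :
    ((Finset.univ : Finset (ZMod (n + 2))).filter fun v => IsCentral m T v).card = d * s := by
  obtain ⟨j, hj⟩ := exists_rotate_isCentral hT hNm hd hm
  have hT' := mapDiagonals_mem_symDissections hT j
  obtain ⟨s', hs', hsn', hout, htype⟩ := exists_type_eq hT' hj hNm hd hm
  obtain ⟨h3, h4⟩ := mem_symDissections.1 hT'
  obtain ⟨rfl, -⟩ := eq_of_type_eq hd hs hs' hsn hsn' fun i => by rw [← hμ, htype]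
  rw [← card_isCentral_of_zero (mem_dissections.1 h3).1 h4 hj hNm hd hm hout]
  refine Finset.card_bij (fun v _ => v - j) ?_ ?_ ?_
  · intro v hv
    rw [Finset.mem_filter, isCentral_mapDiagonals, sub_add_cancel]
    exact ⟨Finset.mem_univ _, (Finset.mem_filter.1 hv).2⟩
  · intro v _ w _ h
    exact sub_left_injective h
  · intro v hv
    exact ⟨v + j, Finset.mem_filter.2 ⟨Finset.mem_univ _,
      isCentral_mapDiagonals.1 (Finset.mem_filter.1 hv).2⟩, add_sub_cancel_right _ _⟩

theorem mul_card_symDissections (hNm : n + 2 = d * m) (hd : 2 ≤ d) (hm : 0 < m) {s : ℕ}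
    {ν : Fin n → ℕ} (hs : 0 < s) (hsn : d * s ≤ n + 2)
    (hμ : ∀ i : Fin n, μ i = d * ν i + if d * s = (i : ℕ) + 3 then 1 else 0) :
    s * (symDissections n m μ).card = m * (arcSystems 0 m s ν).card := by
  classical
  have h := Finset.sum_card_bipartiteAbove_eq_sum_card_bipartiteBelow (fun T v => IsCentral m T v)
    (s := symDissections n m μ) (t := (Finset.univ : Finset (ZMod (n + 2))))
  have h1 : ∀ T ∈ symDissections n m μ,
      (Finset.univ.bipartiteAbove (fun T v => IsCentral m T v) T).card = d * s :=
    fun T hT => card_isCentral hT hNm hd hm hs hsn hμ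
  have h2 : ∀ v ∈ (Finset.univ : Finset (ZMod (n + 2))),
      ((symDissections n m μ).bipartiteBelow (fun T v => IsCentral m T v) v).card =
        (arcSystems 0 m s ν).card := by
    intro v _
    rw [← card_symDissections_isCentral hNm hd hm hs hsn hμ]
    refine Finset.card_bij (fun T _ =>
      mapDiagonals (rotationGen (n + 2) ^ v.val : RotationGroup (n + 2)).1 T) ?_ ?_ ?_
    · intro T hT
      obtain ⟨h3, h4⟩ := Finset.mem_filter.1 hT
      refine Finset.mem_filter.2 ⟨mapDiagonals_mem_symDissections h3 _,
        isCentral_mapDiagonals.2 ?_⟩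
      rwa [ZMod.natCast_zmod_val, zero_add]
    · intro T _ T' _ h
      exact Finset.image_injective (Sym2.map.injective (Equiv.injective _)) h
    · intro T hT
      obtain ⟨h3, h4⟩ := Finset.mem_filter.1 hT
      have hcomp : mapDiagonals (rotationGen (n + 2) ^ v.val : RotationGroup (n + 2)).1
          (mapDiagonals (rotationGen (n + 2) ^ (-v).val : RotationGroup (n + 2)).1 T) = T := by
        ext p
        induction p with | _ a b
        rw [mem_mapDiagonals_pow, mem_mapDiagonals_pow]
        simp
      refine ⟨mapDiagonals (rotationGen (n + 2) ^ (-v).val : RotationGroup (n + 2)).1 T,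
        Finset.mem_filter.2 ⟨mapDiagonals_mem_symDissections h3 _,
          isCentral_mapDiagonals.2 ?_⟩, hcomp⟩
      rwa [ZMod.natCast_zmod_val, add_neg_cancel]
  rw [Finset.sum_congr rfl h1, Finset.sum_congr rfl h2, Finset.sum_const, Finset.sum_const,
    Finset.card_univ, ZMod.card, smul_eq_mul, smul_eq_mul] at h
  apply Nat.eq_of_mul_eq_mul_left (show 0 < d by omega)
  rw [← mul_assoc, ← mul_assoc, ← hNm, ← h, mul_comm]

theorem sum_ite_add_three (f : ℕ → ℕ) (t : ℕ) (ht : t ≤ n + 2) (h2 : 2 ≤ t) :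
    ∑ i : Fin n, f i * (if t = (i : ℕ) + 3 then 1 else 0) = if t = 2 then 0 else f (t - 3) := by
  split_ifs with h
  · exact Finset.sum_eq_zero fun i _ => by rw [if_neg (by omega), mul_zero]
  · rw [Finset.sum_eq_single_of_mem (⟨t - 3, by omega⟩ : Fin n) (Finset.mem_univ _)]
    · rw [if_pos (by simp only; omega), mul_one]
    · intro i _ hi
      rw [if_neg, mul_zero]
      intro hti
      exact hi (Fin.ext (by simp only; omega))

theorem sum_add_eq (hμn : ∑ i : Fin n, ((i : ℕ) + 1) * μ i = n) (hNm : n + 2 = d * m)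
    (hd : 2 ≤ d) {s : ℕ} {ν : Fin n → ℕ} (hs : 0 < s) (hsn : d * s ≤ n + 2)
    (hμ : ∀ i : Fin n, μ i = d * ν i + if d * s = (i : ℕ) + 3 then 1 else 0) :
    ∑ i : Fin n, ((i : ℕ) + 1) * ν i + s = m := by
  have h2 : d * 1 ≤ d * s := Nat.mul_le_mul_left d hs
  have h3 := sum_ite_add_three (fun i => i + 1) (d * s) hsn (by omega)
  have h4 : d * ∑ i : Fin n, ((i : ℕ) + 1) * ν i +
      ∑ i : Fin n, ((i : ℕ) + 1) * (if d * s = (i : ℕ) + 3 then 1 else 0) = n := by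
    conv_rhs => rw [← hμn]
    rw [Finset.mul_sum, ← Finset.sum_add_distrib]
    refine Finset.sum_congr rfl fun i _ => ?_
    rw [hμ]
    ring
  apply Nat.eq_of_mul_eq_mul_left (show 0 < d by omega)
  rw [← hNm, mul_add]
  rw [h3] at h4
  split_ifs at h4 <;> omega

theorem card_symDissections_mul (hμn : ∑ i : Fin n, ((i : ℕ) + 1) * μ i = n)
    (hNm : n + 2 = d * (m + 1)) (hd : 2 ≤ d) {s : ℕ} {ν : Fin n → ℕ} (hs : 0 < s)
    (hsn : d * s ≤ n + 2)
    (hμ : ∀ i : Fin n, μ i = d * ν i + if d * s = (i : ℕ) + 3 then 1 else 0) :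
    (symDissections n (m + 1) μ).card * (m.factorial * ∏ i, (ν i).factorial) =
      (m + ∑ i, ν i).factorial := by
  have h1 := mul_card_symDissections hNm hd (Nat.succ_pos m) hs hsn hμ
  have h2m := two_mul_le_of_eq hNm hd
  have h2 := card_arcSystems 0 m s ν (by omega) (sum_add_eq hμn hNm hd hs hsn hμ)
  rw [zero_add, Nat.factorial_succ] at h2
  apply Nat.eq_of_mul_eq_mul_left hs
  rw [← h2, ← mul_assoc, h1]
  ring

theorem card_dissections_mul (hn : 1 ≤ n) (hμn : ∑ i : Fin n, ((i : ℕ) + 1) * μ i = n) :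
    (dissections n μ).card * ((n + 1).factorial * ∏ i, (μ i).factorial) =
      (n + ∑ i, μ i).factorial := by
  have h := card_arcSystems 0 n 1 μ le_rfl (by rw [hμn])
  rw [zero_add, one_mul] at h
  rw [card_dissections_eq_card_arcSystems hn, h]

end Count

/-! ### The values of `a_μ` at roots of unity -/

section Values

variable {n d m : ℕ} {μ : Fin n → ℕ}

theorem sum_mod_le_one (hNm : n + 2 = d * m) (hd : 2 ≤ d) (hm : 0 < m)
    (h : (symDissections n m μ).Nonempty) : ∑ i, μ i % d ≤ 1 := by
  obtain ⟨T, hT⟩ := h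
  obtain ⟨j, hj⟩ := exists_rotate_isCentral hT hNm hd hm
  obtain ⟨s, hs, hsn, -, htype⟩ :=
    exists_type_eq (mapDiagonals_mem_symDissections hT j) hj hNm hd hm
  have h2 : d * 1 ≤ d * s := Nat.mul_le_mul_left d hs
  have h3 := sum_ite_add_three (n := n) (fun _ => 1) (d * s) hsn (by omega)
  have h4 (i : Fin n) : μ i % d = 1 * if d * s = (i : ℕ) + 3 then 1 else 0 := by
    rw [htype i, Nat.mul_add_mod, one_mul]
    split_ifs
    · exact Nat.mod_eq_of_lt (by omega)
    · exact Nat.zero_mod d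
  rw [Finset.sum_congr rfl fun i _ => h4 i, h3]
  split_ifs <;> omega

theorem exists_type_of_sum_mod_le_one (hμn : ∑ i : Fin n, ((i : ℕ) + 1) * μ i = n)
    (hNm : n + 2 = d * m) (hd : 2 ≤ d) (h : ∑ i, μ i % d ≤ 1) :
    ∃ s, 0 < s ∧ d * s ≤ n + 2 ∧
      ∀ i : Fin n, μ i = d * (μ i / d) + if d * s = (i : ℕ) + 3 then 1 else 0 := by
  have hsum : d * ∑ i : Fin n, ((i : ℕ) + 1) * (μ i / d) +
      ∑ i : Fin n, ((i : ℕ) + 1) * (μ i % d) = n := by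
    conv_rhs => rw [← hμn]
    rw [Finset.mul_sum, ← Finset.sum_add_distrib]
    refine Finset.sum_congr rfl fun i _ => ?_
    conv_rhs => rw [← Nat.div_add_mod (μ i) d]
    ring
  by_cases h0 : ∑ i, μ i % d = 0
  · have hz (i : Fin n) : μ i % d = 0 := Finset.sum_eq_zero_iff.1 h0 i (Finset.mem_univ i)
    have hd2 : d ∣ 2 := by
      simp only [hz, mul_zero, Finset.sum_const_zero, add_zero] at hsum
      exact (Nat.dvd_add_right (show d ∣ n from ⟨_, hsum.symm⟩)).1 ⟨m, hNm⟩
    have hd2' : d = 2 := le_antisymm (Nat.le_of_dvd two_pos hd2) hd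
    refine ⟨1, one_pos, by omega, fun i => ?_⟩
    rw [if_neg (by omega)]
    conv_lhs => rw [← Nat.div_add_mod (μ i) d, hz i]
  · obtain ⟨i₀, hi₀⟩ : ∃ i, μ i % d ≠ 0 := by
      by_contra! hcon
      exact h0 (Finset.sum_eq_zero fun i _ => hcon i)
    have hsplit := Finset.add_sum_erase Finset.univ (fun i => μ i % d) (Finset.mem_univ i₀)
    have h1 : μ i₀ % d = 1 := by omega
    have hz (i : Fin n) (hi : i ≠ i₀) : μ i % d = 0 :=
      Finset.sum_eq_zero_iff.1 (show ∑ i ∈ Finset.univ.erase i₀, μ i % d = 0 by omega) i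
        (Finset.mem_erase.2 ⟨hi, Finset.mem_univ i⟩)
    have hrem : ∑ i : Fin n, ((i : ℕ) + 1) * (μ i % d) = i₀ + 1 := by
      rw [Finset.sum_eq_single_of_mem i₀ (Finset.mem_univ _)
        (fun i _ hi => by rw [hz i hi, mul_zero]), h1, mul_one]
    rw [hrem] at hsum
    obtain ⟨s, hs⟩ : d ∣ (i₀ : ℕ) + 3 := by
      have hdvd : d ∣ d * ∑ i : Fin n, ((i : ℕ) + 1) * (μ i / d) + ((i₀ : ℕ) + 3) := ⟨m, by omega⟩
      exact (Nat.dvd_add_right (dvd_mul_right _ _)).1 hdvd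
    have := i₀.2
    refine ⟨s, Nat.pos_of_ne_zero ?_, by omega, fun i => ?_⟩
    · rintro rfl
      omega
    · conv_lhs => rw [← Nat.div_add_mod (μ i) d]
      congr 1
      by_cases hi : i = i₀
      · rw [hi, h1, if_pos hs.symm]
      · rw [hz i hi, if_neg]
        intro h
        exact hi (Fin.ext (by omega))

theorem aeval_eq_card_symDissections (hμn : ∑ i : Fin n, ((i : ℕ) + 1) * μ i = n) {P : ℤ[X]}
    (hP : qFactorial (n + ∑ i, μ i) = qFactorial (n + 1) * (∏ i, qFactorial (μ i)) * P)
    (hNm : n + 2 = d * m) (hd : 2 ≤ d) {ω : ℂ} (hω : IsPrimitiveRoot ω d) :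
    aeval ω P = ((symDissections n m μ).card : ℂ) := by
  have hm : 0 < m := Nat.pos_of_ne_zero (by rintro rfl; omega)
  by_cases hR : ∑ i, μ i % d ≤ 1
  · obtain ⟨s, hs, hsn, hμ⟩ := exists_type_of_sum_mod_le_one hμn hNm hd hR
    obtain ⟨m, rfl⟩ : ∃ c, m = c + 1 := ⟨m - 1, by omega⟩
    have h2 : d * 1 ≤ d * s := Nat.mul_le_mul_left d hs
    have hδ := sum_ite_add_three (n := n) (fun _ => 1) (d * s) hsn (by omega)
    simp only [one_mul] at hδ
    have h3 := aeval_mul_eq_factorial hP hω hd hNm hμ (by rw [hδ]; split_ifs <;> omega) (by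
      rw [hδ]
      split_ifs with h
      · left; omega
      · exact Or.inr rfl)
    have h4 := congrArg (Nat.cast : ℕ → ℂ) (card_symDissections_mul hμn hNm hd hs hsn hμ)
    push_cast at h4
    refine mul_right_cancel₀ ?_ (h3.trans h4.symm)
    exact mul_ne_zero (Nat.cast_ne_zero.2 (Nat.factorial_ne_zero _))
      (Finset.prod_ne_zero_iff.2 fun i _ => Nat.cast_ne_zero.2 (Nat.factorial_ne_zero _))
  · rw [aeval_eq_zero hP hω hd ⟨m, hNm⟩ (by omega), Finset.not_nonempty_iff_eq_empty.1
      (mt (sum_mod_le_one hNm hd hm) hR)]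
    simp

theorem aeval_one_eq_card_symDissections (hn : 1 ≤ n)
    (hμn : ∑ i : Fin n, ((i : ℕ) + 1) * μ i = n) {P : ℤ[X]}
    (hP : qFactorial (n + ∑ i, μ i) = qFactorial (n + 1) * (∏ i, qFactorial (μ i)) * P) :
    aeval (1 : ℂ) P = ((symDissections n (n + 2) μ).card : ℂ) := by
  have hsym : symDissections n (n + 2) μ = dissections n μ := by
    ext T
    rw [mem_symDissections, and_iff_left_iff_imp, ZMod.natCast_self]
    intro _ a b hab
    simpa using hab
  have h := congrArg (Nat.cast : ℕ → ℂ) (card_dissections_mul hn hμn)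
  push_cast at h
  rw [hsym]
  refine mul_right_cancel₀ ?_ ((aeval_one_mul_eq_factorial hP).trans h.symm)
  exact mul_ne_zero (Nat.cast_ne_zero.2 (Nat.factorial_ne_zero _))
    (Finset.prod_ne_zero_iff.2 fun i _ => Nat.cast_ne_zero.2 (Nat.factorial_ne_zero _))

theorem card_fixedBy (μ : Fin n → ℕ) (j : ℕ) :
    Nat.card (MulAction.fixedBy (DissectionsOfType n μ) (rotationGen (n + 2) ^ j)) =
      (symDissections n (Nat.gcd (n + 2) j) μ).card := by
  rw [← Set.ncard_coe_finset, Nat.card_coe_set_eq,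
    ← Set.ncard_image_of_injective _ (f := fun T : DissectionsOfType n μ => T.1)
      Subtype.val_injective]
  congr 1
  ext T
  simp only [Set.mem_image, Finset.mem_coe, mem_symDissections, mem_dissections,
    ← mapDiagonals_pow_eq_self_iff, MulAction.mem_fixedBy]
  constructor
  · rintro ⟨S, hS, rfl⟩
    exact ⟨S.2, congrArg Subtype.val hS⟩
  · rintro ⟨h1, h2⟩
    exact ⟨⟨T, h1⟩, Subtype.ext h2, rfl⟩

theorem orderOf_rotation (N : ℕ) : orderOf (rotation N) = N := by
  refine Nat.dvd_antisymm (orderOf_dvd_of_pow_eq_one ?_) ?_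
  · ext x
    have := rotationGen_pow_apply N N x
    rw [ZMod.natCast_self, sub_zero] at this
    exact this
  · have h := rotationGen_pow_apply N (orderOf (rotation N)) 0
    rw [Subgroup.coe_pow, rotationGen, pow_orderOf_eq_one, Equiv.Perm.one_apply, zero_sub,
      eq_comm, neg_eq_zero] at h
    exact (ZMod.natCast_eq_zero_iff _ _).1 h

end Values

end PolygonDissection

open PolygonDissection in
theorem theorem2p3 (n : ℕ) (hn : 1 ≤ n) (μ : Fin n → ℕ)
    (hμ : ∑ i : Fin n, ((i : ℕ) + 1) * μ i = n) :
    ∃ P : ℤ[X],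
      algebraMap ℤ[X] PolygonDissection.QField P = PolygonDissection.aMu n μ ∧
      PolygonDissection.ExhibitsCSP (n + 2) (PolygonDissection.RotationGroup (n + 2))
        (PolygonDissection.DissectionsOfType n μ) (PolygonDissection.rotationGen (n + 2)) P := by
  obtain ⟨P, hP⟩ := qFactorial_mul_prod_dvd hμ
  refine ⟨P, algebraMap_eq_aMu hP, ?_, ?_, ?_, ?_⟩
  · exact Subtype.finite
  · rw [Nat.card_zpowers, orderOf_rotation]
  · rintro ⟨g, k, rfl⟩
    exact ⟨k, Subtype.ext (Subgroup.coe_zpow _ _ _)⟩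
  · intro ζ hζ j
    rw [card_fixedBy]
    obtain ⟨d, hd⟩ := Nat.gcd_dvd_left (n + 2) j
    have hg : 0 < Nat.gcd (n + 2) j := Nat.gcd_pos_of_pos_left j (by omega)
    have hω : IsPrimitiveRoot (ζ ^ j) d := by
      have h := IsPrimitiveRoot.orderOf (ζ ^ j)
      have hfin : IsOfFinOrder ζ := isOfFinOrder_iff_pow_eq_one.2 ⟨n + 2, by omega, hζ.pow_eq_one⟩
      rwa [hfin.orderOf_pow, ← hζ.eq_orderOf, Nat.div_eq_of_eq_mul_right hg hd] at h
    rw [mul_comm] at hd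
    rcases Nat.lt_or_ge d 2 with h | h
    · have hd1 : d = 1 := by
        interval_cases d
        · omega
        · rfl
      subst hd1
      rw [one_mul] at hd
      rw [← hd, IsPrimitiveRoot.one_right_iff.1 hω]
      exact aeval_one_eq_card_symDissections hn hμ hP
    · exact aeval_eq_card_symDissections hμ hP hd h hω
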